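/- Let $0<\alpha<1$, $\Omega^+=\{(x,y):0<x<1,\ 0<y<1\}$, $\Omega^-=\{(x,y):-y<x<y+1,\ -\tfrac12<y<0\}$, $AB=\{(x,0):0<x<1\}$ and $\Omega=\Omega^+\cup\Omega^-\cup AB$. Write $${}_CD^{\alpha}_{0y}f(y)=\frac1{\Gamma(1-\alpha)}\int_0^y (y-t)^{-\alpha}f'(t)\,dt$$ for the Caputo derivative (with $f'$ existing on $(0,y)$ and the integral absolutely convergent), and let $W$ be the class of functions $u\in C(\overline\Omega)\cap C^2(\Omega^-)$ such that $u_{xx}$ and ${}_CD^{\alpha}_{0y}u$ exist and are continuous in $\Omega^+$. Let $\gamma_1,\gamma_2\in\mathbb R$ with $\gamma_1^2+\gamma_2^2\neq0$, and let $\varphi_1,\varphi_2$ (on $[0,1]$), $\psi$ (on $[0,\tfrac12]$) and $Q$ be given real functions with $\varphi_1(0)=\psi(0)$. Consider the problem of finding $u\in W$ such that $$u_{xx}-{}_CD^{\alpha}_{0y}u=0\ \text{ in }\Omega^+,\qquad u_{xx}-u_{yy}=0\ \text{ in }\Omega^-,$$ $$u(0,y)=\varphi_1(y),\quad u(1,y)=\varphi_2(y)\quad(0\le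 y\le1),\qquad u(x,-x)=\psi(x)\quad(0\le x\le\tfrac12),$$ $$\lim_{y\to+0}y^{1-\alpha}u_y(x,y)=\gamma_1u_y(x,-0)+\gamma_2\int_0^x u_y(t,-0)\,Q(x,t)\,dt\qquad(0<x<1),$$ where $u_y(x,-0)=\lim_{y\to-0}u_y(x,y)$, the limits are assumed to exist, and the integral may be improper at $t=0$. Assume that $Q$ is continuous on $\{0\le t\le x\le1\}$, that there is a continuous function $Q_1:[0,1]\to\mathbb R$ with $\frac{\partial}{\partial t}Q(x,t)=-Q_1(x)Q_1(t)$ for $0<t<x<1$, that $Q(x,x)>0$ for $0<x<1$, and that $\gamma_2\ge0$. Then the problem has at most one solution: any two solutions in $W$ coincide on $\overline\Omega$. -/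

import Mathlib

open Set Filter Topology MeasureTheory

namespace TricomiCaputo

/-- The rectangular (parabolic) part: `0 < x < 1`, `0 < y < 1`. -/
def OmegaPlus : Set (ℝ × ℝ) :=
  {p | 0 < p.1 ∧ p.1 < 1 ∧ 0 < p.2 ∧ p.2 < 1}

/-- The characteristic triangle (hyperbolic part): `-y < x < y + 1`, `-1/2 < y < 0`. -/
def OmegaMinus : Set (ℝ × ℝ) :=
  {p | -p.2 < p.1 ∧ p.1 < p.2 + 1 ∧ -(1 / 2) < p.2 ∧ p.2 < 0}

/-- The open segment `AB`, on which the equation changes type. -/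
def segmentAB : Set (ℝ × ℝ) :=
  {p | 0 < p.1 ∧ p.1 < 1 ∧ p.2 = 0}

/-- The mixed domain. -/
def Omega : Set (ℝ × ℝ) :=
  OmegaPlus ∪ OmegaMinus ∪ segmentAB

/-- The partial derivative `u_x`. -/
noncomputable def partialX (u : ℝ × ℝ → ℝ) (p : ℝ × ℝ) : ℝ :=
  deriv (fun s => u (s, p.2)) p.1

/-- The partial derivative `u_y`. -/
noncomputable def partialY (u : ℝ × ℝ → ℝ) (p : ℝ × ℝ) : ℝ :=
  deriv (fun s => u (p.1, s)) p.2

/-- The Caputo derivative of order `α ∈ (0, 1)` with base point `0`, at `y > 0`. -/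
noncomputable def caputo (α : ℝ) (f : ℝ → ℝ) (y : ℝ) : ℝ :=
  1 / Real.Gamma (1 - α) * ∫ t in (0 : ℝ)..y, (y - t) ^ (-α) * deriv f t

/-- The Caputo derivative of `f` at `y` makes sense: `f'` exists on `(0, y)` and the integral
defining the Caputo derivative converges absolutely. -/
def HasCaputo (α : ℝ) (f : ℝ → ℝ) (y : ℝ) : Prop :=
  (∀ t ∈ Ioo 0 y, DifferentiableAt ℝ f t) ∧
    IntervalIntegrable (fun t => (y - t) ^ (-α) * deriv f t) volume 0 y

/-- The partial Caputo derivative in `y`. -/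
noncomputable def caputoY (α : ℝ) (u : ℝ × ℝ → ℝ) (p : ℝ × ℝ) : ℝ :=
  caputo α (fun s => u (p.1, s)) p.2

/-- The class `W`: `u ∈ C(closure Ω) ∩ C²(Ω⁻)`, with `u_xx` and the Caputo derivative existing and
continuous in `Ω⁺`. -/
structure MemW (α : ℝ) (u : ℝ × ℝ → ℝ) : Prop where
  continuousOn : ContinuousOn u (closure Omega)
  contDiffOn : ContDiffOn ℝ 2 u OmegaMinus
  differentiable_x : ∀ p ∈ OmegaPlus, DifferentiableAt ℝ (fun s => u (s, p.2)) p.1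
  differentiable_xx : ∀ p ∈ OmegaPlus, DifferentiableAt ℝ (fun s => partialX u (s, p.2)) p.1
  continuousOn_xx : ContinuousOn (partialX (partialX u)) OmegaPlus
  hasCaputo : ∀ p ∈ OmegaPlus, HasCaputo α (fun s => u (p.1, s)) p.2
  continuousOn_caputo : ContinuousOn (caputoY α u) OmegaPlus

/-- `J` is the integral of `f` from `0` to `x`, possibly improper at `0`: `f` is integrable on
`[ε, x]` for `0 < ε < x`, and the integrals over `[ε, x]` tend to `J` as `ε → 0+`.
If `f` is integrable on `(0, x)`, then `J` is the usual integral. -/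
def HasImproperIntegral (f : ℝ → ℝ) (x J : ℝ) : Prop :=
  (∀ ε ∈ Ioo 0 x, IntervalIntegrable f volume ε x) ∧
    Tendsto (fun ε => ∫ t in ε..x, f t) (𝓝[>] 0) (𝓝 J)

/-- The gluing condition
`lim_{y → 0+} y^(1-α) u_y(x, y) = γ₁ u_y(x, -0) + γ₂ ∫_0^x u_y(t, -0) Q(x, t) dt` for `0 < x < 1`,
all limits and integrals in it being required to exist; here `ν x` is `u_y(x, -0)`. -/
def Gluing (α γ₁ γ₂ : ℝ) (Q : ℝ → ℝ → ℝ) (u : ℝ × ℝ → ℝ) : Prop :=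
  ∃ ν : ℝ → ℝ,
    (∀ x ∈ Ioo (0 : ℝ) 1, Tendsto (fun y => partialY u (x, y)) (𝓝[<] 0) (𝓝 (ν x))) ∧
    ∀ x ∈ Ioo (0 : ℝ) 1, ∃ J : ℝ,
      HasImproperIntegral (fun t => ν t * Q x t) x J ∧
      Tendsto (fun y => y ^ (1 - α) * partialY u (x, y)) (𝓝[>] 0) (𝓝 (γ₁ * ν x + γ₂ * J))

/-- `u` is a solution, in the class `W`, of the Tricomi problem with integral gluing condition. -/
structure IsSolution (α γ₁ γ₂ : ℝ) (Q : ℝ → ℝ → ℝ) (φ₁ φ₂ ψ : ℝ → ℝ) (u : ℝ × ℝ → ℝ) :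
    Prop where
  memW : MemW α u
  eq_plus : ∀ p ∈ OmegaPlus, partialX (partialX u) p - caputoY α u p = 0
  eq_minus : ∀ p ∈ OmegaMinus, partialX (partialX u) p - partialY (partialY u) p = 0
  left : ∀ y ∈ Icc (0 : ℝ) 1, u (0, y) = φ₁ y
  right : ∀ y ∈ Icc (0 : ℝ) 1, u (1, y) = φ₂ y
  characteristic : ∀ x ∈ Icc (0 : ℝ) (1 / 2), u (x, -x) = ψ x
  gluing : Gluing α γ₁ γ₂ Q u

end TricomiCaputo

/-! ### Linearity: reduction to zero data. -/

namespace TricomiCaputo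

/-! By linearity, the difference `w` of two solutions solves the problem with zero data. Write `τ x
= w (x, 0)`; everything reduces to `τ = 0`.

In the triangle, d'Alembert's formula and the zero characteristic data give `w (x, y) = τ (x + y)`
(`eq_trace_of_wave`). Hence `τ` is C² on `(0, 1)` and `u_y(x, -0) = τ' x`. Since `∂Q/∂t` is a
product, integration by parts turns the gluing integral into `τ x * Q x x + Q₁ x * S x`, where `S`
is the primitive of `Q₁ τ` (`improperIntegral_eq`).

In the rectangle, if `y ^ (1 - α) * u_y → μ`, then the Caputo derivative tends to a positive
constant times `μ` (`tendsto_caputo`), so `u_xx` has that limit too, but only pointwise in `x`.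
Baire's theorem and a test function identify the limit with `τ''` (`second_deriv_eq_of_tendsto`).

The result is `τ'' = A τ' + B (Q(x,x) τ + Q₁ S)` with `B ≥ 0` and `τ 0 = τ 1 = 0`. A monotone energy
forces `τ = 0` (`eq_zero_of_integro_ode`). Then `w` vanishes in the triangle, and the maximum
principle based on Luchko's inequality (`nonpos_of_diffusion`) settles the rectangle. -/

theorem isOpen_OmegaMinus : IsOpen OmegaMinus := by
  unfold OmegaMinus
  simp only [ofPred_and]
  refine (isOpen_lt ?_ ?_).inter ((isOpen_lt ?_ ?_).inter ((isOpen_lt ?_ ?_).inter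
    (isOpen_lt ?_ ?_))) <;> fun_prop

theorem Icc_prod_Icc_subset_closure_Omega :
    Icc (0 : ℝ) 1 ×ˢ Icc (0 : ℝ) 1 ⊆ closure Omega := by
  have h : OmegaPlus = Ioo (0 : ℝ) 1 ×ˢ Ioo (0 : ℝ) 1 := by
    ext p; simp [OmegaPlus, and_assoc]
  have h1 : closure OmegaPlus = Icc (0 : ℝ) 1 ×ˢ Icc (0 : ℝ) 1 := by
    rw [h, closure_prod_eq, closure_Ioo (by norm_num)]
  rw [← h1]
  exact closure_mono fun p hp => Or.inl (Or.inl hp)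

theorem deriv_deriv_sub {f g : ℝ → ℝ} {x : ℝ} (hf : ∀ᶠ s in 𝓝 x, DifferentiableAt ℝ f s)
    (hg : ∀ᶠ s in 𝓝 x, DifferentiableAt ℝ g s) (hf' : DifferentiableAt ℝ (deriv f) x)
    (hg' : DifferentiableAt ℝ (deriv g) x) :
    DifferentiableAt ℝ (deriv fun s => f s - g s) x ∧
      deriv (deriv fun s => f s - g s) x = deriv (deriv f) x - deriv (deriv g) x := by
  have h : (deriv fun s => f s - g s) =ᶠ[𝓝 x] fun s => deriv f s - deriv g s := by
    filter_upwards [hf, hg] with s h1 h2 using deriv_fun_sub h1 h2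
  exact ⟨(hf'.sub hg').congr_of_eventuallyEq h, by rw [h.deriv_eq, deriv_fun_sub hf' hg']⟩

theorem eventually_differentiableAt_of_contDiffAt_two {f : ℝ → ℝ} {x : ℝ}
    (hf : ContDiffAt ℝ 2 f x) : ∀ᶠ s in 𝓝 x, DifferentiableAt ℝ f s :=
  (hf.eventually (by simp)).mono fun _ h => h.differentiableAt (by simp)

theorem differentiableAt_deriv_of_contDiffAt_two {f : ℝ → ℝ} {x : ℝ}
    (hf : ContDiffAt ℝ 2 f x) : DifferentiableAt ℝ (deriv f) x :=
  (hf.derivWithin (m := 1) (by norm_num)).differentiableAt (by simp)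

variable {α γ₁ γ₂ : ℝ} {Q : ℝ → ℝ → ℝ} {φ₁ φ₂ ψ : ℝ → ℝ} {u v w : ℝ × ℝ → ℝ}

theorem eqOn_caputo_integrand_sub {f g : ℝ → ℝ} {y : ℝ} (hf : HasCaputo α f y) (hg : HasCaputo α g y)
    (hy : 0 < y) :
    EqOn (fun t => (y - t) ^ (-α) * deriv (fun s => f s - g s) t)
      (fun t => (y - t) ^ (-α) * deriv f t - (y - t) ^ (-α) * deriv g t) (uIoo 0 y) := by
  intro t ht
  rw [uIoo_of_le hy.le] at ht
  simp only
  rw [deriv_fun_sub (hf.1 t ht) (hg.1 t ht)]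
  ring

theorem HasCaputo.sub {f g : ℝ → ℝ} {y : ℝ} (hf : HasCaputo α f y)
    (hg : HasCaputo α g y) (hy : 0 < y) : HasCaputo α (fun s => f s - g s) y := by
  refine ⟨fun t ht => (hf.1 t ht).sub (hg.1 t ht), ?_⟩
  exact (intervalIntegrable_congr_uIoo (eqOn_caputo_integrand_sub hf hg hy)).2 (hf.2.sub hg.2)

theorem caputo_sub {f g : ℝ → ℝ} {y : ℝ} (hf : HasCaputo α f y)
    (hg : HasCaputo α g y) (hy : 0 < y) :
    caputo α (fun s => f s - g s) y = caputo α f y - caputo α g y := by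
  unfold caputo
  rw [intervalIntegral.integral_congr_uIoo (eqOn_caputo_integrand_sub hf hg hy),
    intervalIntegral.integral_sub hf.2 hg.2]
  ring

namespace MemW

theorem contDiffAt (hu : MemW α u) {p : ℝ × ℝ} (hp : p ∈ OmegaMinus) : ContDiffAt ℝ 2 u p :=
  hu.contDiffOn.contDiffAt (isOpen_OmegaMinus.mem_nhds hp)

theorem contDiffAt_left (hu : MemW α u) {p : ℝ × ℝ} (hp : p ∈ OmegaMinus) :
    ContDiffAt ℝ 2 (fun s => u (s, p.2)) p.1 :=
  ContDiffAt.comp (f := fun s : ℝ => (s, p.2)) p.1 (hu.contDiffAt hp) (by fun_prop)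

theorem contDiffAt_right (hu : MemW α u) {p : ℝ × ℝ} (hp : p ∈ OmegaMinus) :
    ContDiffAt ℝ 2 (fun s => u (p.1, s)) p.2 :=
  ContDiffAt.comp (f := fun s : ℝ => (p.1, s)) p.2 (hu.contDiffAt hp) (by fun_prop)

theorem differentiableAt_right (hu : MemW α u) {x y : ℝ} (hx : x ∈ Ioo (0 : ℝ) 1)
    (hy : y ∈ Ioo (0 : ℝ) 1) : DifferentiableAt ℝ (fun s => u (x, s)) y := by
  obtain ⟨hy0, hy1⟩ := hy
  -- `HasCaputo` at a height gives differentiability strictly below it only, hence the higher point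
  -- `(y + 1) / 2 < 1`.
  exact (hu.hasCaputo (x, (y + 1) / 2) ⟨hx.1, hx.2, by simp; linarith, by simp; linarith⟩).1 y
    ⟨hy0, by simp; linarith⟩

theorem eventually_differentiableAt_left (hu : MemW α u) {p : ℝ × ℝ} (hp : p ∈ OmegaPlus) :
    ∀ᶠ s in 𝓝 p.1, DifferentiableAt ℝ (fun s => u (s, p.2)) s := by
  filter_upwards [Ioo_mem_nhds hp.1 hp.2.1] with s hs
  exact hu.differentiable_x (s, p.2) ⟨hs.1, hs.2, hp.2.2⟩

theorem partialX_partialX_sub (hu : MemW α u) (hv : MemW α v) {p : ℝ × ℝ} (hp : p ∈ OmegaPlus) :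
    DifferentiableAt ℝ (fun s => partialX (fun q => u q - v q) (s, p.2)) p.1 ∧
      partialX (partialX fun q => u q - v q) p =
        partialX (partialX u) p - partialX (partialX v) p :=
  deriv_deriv_sub (hu.eventually_differentiableAt_left hp) (hv.eventually_differentiableAt_left hp)
    (hu.differentiable_xx p hp) (hv.differentiable_xx p hp)

theorem caputoY_sub (hu : MemW α u) (hv : MemW α v) {p : ℝ × ℝ} (hp : p ∈ OmegaPlus) :
    caputoY α (fun q => u q - v q) p = caputoY α u p - caputoY α v p :=
  caputo_sub (hu.hasCaputo p hp) (hv.hasCaputo p hp) hp.2.2.1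

theorem sub (hu : MemW α u) (hv : MemW α v) : MemW α fun q => u q - v q where
  continuousOn := hu.continuousOn.sub hv.continuousOn
  contDiffOn := hu.contDiffOn.sub hv.contDiffOn
  differentiable_x _ hp := (hu.differentiable_x _ hp).sub (hv.differentiable_x _ hp)
  differentiable_xx _ hp := (hu.partialX_partialX_sub hv hp).1
  continuousOn_xx := (hu.continuousOn_xx.sub hv.continuousOn_xx).congr fun _ hp =>
    (hu.partialX_partialX_sub hv hp).2
  hasCaputo _ hp := (hu.hasCaputo _ hp).sub (hv.hasCaputo _ hp) hp.2.2.1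
  continuousOn_caputo := (hu.continuousOn_caputo.sub hv.continuousOn_caputo).congr fun _ hp =>
    hu.caputoY_sub hv hp

end MemW

theorem HasImproperIntegral.sub {f g : ℝ → ℝ} {x I J : ℝ} (hx : 0 < x)
    (hf : HasImproperIntegral f x I) (hg : HasImproperIntegral g x J) :
    HasImproperIntegral (fun t => f t - g t) x (I - J) := by
  refine ⟨fun ε hε => (hf.1 ε hε).sub (hg.1 ε hε), (hf.2.sub hg.2).congr' ?_⟩
  filter_upwards [Ioo_mem_nhdsGT hx] with ε hε
  rw [intervalIntegral.integral_sub (hf.1 ε hε) (hg.1 ε hε)]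

theorem eventually_mem_OmegaMinus {x : ℝ} (hx : x ∈ Ioo (0 : ℝ) 1) :
    ∀ᶠ y in 𝓝[<] (0 : ℝ), (x, y) ∈ OmegaMinus := by
  obtain ⟨h0, h1⟩ := hx
  have : max (-x) (max (x - 1) (-(1 / 2))) < (0 : ℝ) := by
    simp only [max_lt_iff]; refine ⟨?_, ?_, ?_⟩ <;> linarith
  filter_upwards [Ioo_mem_nhdsLT this] with y hy
  simp only [mem_Ioo, max_lt_iff] at hy
  simp only [OmegaMinus, mem_ofPred_eq]
  refine ⟨?_, ?_, ?_, ?_⟩ <;> linarith [hy.1.1, hy.1.2.1, hy.1.2.2, hy.2]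

theorem Gluing.sub (hu : MemW α u) (hv : MemW α v) (hgu : Gluing α γ₁ γ₂ Q u)
    (hgv : Gluing α γ₁ γ₂ Q v) : Gluing α γ₁ γ₂ Q fun q => u q - v q := by
  obtain ⟨ν, hν, hJ⟩ := hgu
  obtain ⟨ν', hν', hJ'⟩ := hgv
  refine ⟨fun x => ν x - ν' x, fun x hx => ?_, fun x hx => ?_⟩
  · refine ((hν x hx).sub (hν' x hx)).congr' ?_
    filter_upwards [eventually_mem_OmegaMinus hx] with y hy
    exact (deriv_fun_sub ((hu.contDiffAt_right hy).differentiableAt (by simp))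
      ((hv.contDiffAt_right hy).differentiableAt (by simp))).symm
  · obtain ⟨J, h1, h2⟩ := hJ x hx
    obtain ⟨J', h1', h2'⟩ := hJ' x hx
    refine ⟨J - J', ?_, ?_⟩
    · simpa only [sub_mul] using h1.sub hx.1 h1'
    · have e : γ₁ * (ν x - ν' x) + γ₂ * (J - J') = γ₁ * ν x + γ₂ * J - (γ₁ * ν' x + γ₂ * J') := by
        ring
      rw [e]
      refine (h2.sub h2').congr' ?_
      filter_upwards [Ioo_mem_nhdsGT one_pos] with y hy
      rw [← mul_sub]
      congr 1
      exact (deriv_fun_sub (hu.differentiableAt_right hx hy)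
        (hv.differentiableAt_right hx hy)).symm

theorem IsSolution.sub (hu : IsSolution α γ₁ γ₂ Q φ₁ φ₂ ψ u)
    (hv : IsSolution α γ₁ γ₂ Q φ₁ φ₂ ψ v) :
    IsSolution α γ₁ γ₂ Q 0 0 0 fun q => u q - v q where
  memW := hu.memW.sub hv.memW
  eq_plus p hp := by
    rw [(hu.memW.partialX_partialX_sub hv.memW hp).2, hu.memW.caputoY_sub hv.memW hp]
    linarith [hu.eq_plus p hp, hv.eq_plus p hp]
  eq_minus p hp := by
    have hx := (deriv_deriv_sub
      (eventually_differentiableAt_of_contDiffAt_two (hu.memW.contDiffAt_left hp))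
      (eventually_differentiableAt_of_contDiffAt_two (hv.memW.contDiffAt_left hp))
      (differentiableAt_deriv_of_contDiffAt_two (hu.memW.contDiffAt_left hp))
      (differentiableAt_deriv_of_contDiffAt_two (hv.memW.contDiffAt_left hp))).2
    have hy := (deriv_deriv_sub
      (eventually_differentiableAt_of_contDiffAt_two (hu.memW.contDiffAt_right hp))
      (eventually_differentiableAt_of_contDiffAt_two (hv.memW.contDiffAt_right hp))
      (differentiableAt_deriv_of_contDiffAt_two (hu.memW.contDiffAt_right hp))
      (differentiableAt_deriv_of_contDiffAt_two (hv.memW.contDiffAt_right hp))).2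
    have hu' := hu.eq_minus p hp
    have hv' := hv.eq_minus p hp
    simp only [partialX, partialY] at hu' hv' ⊢
    linarith
  left y hy := by simp [hu.left y hy, hv.left y hy]
  right y hy := by simp [hu.right y hy, hv.right y hy]
  characteristic x hx := by simp [hu.characteristic x hx, hv.characteristic x hx]
  gluing := hu.gluing.sub hu.memW hv.memW hv.gluing

end TricomiCaputo

/-! ### The wave equation in the triangle and the trace on `AB`. -/

namespace TricomiCaputo

variable {α γ₁ γ₂ : ℝ} {Q : ℝ → ℝ → ℝ} {φ₁ φ₂ ψ : ℝ → ℝ} {u v w : ℝ × ℝ → ℝ}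

theorem eq_of_hasDerivAt_zero_Ioo {f : ℝ → ℝ} {a b x y : ℝ}
    (hf : ∀ z ∈ Ioo a b, HasDerivAt f 0 z) (hx : x ∈ Ioo a b) (hy : y ∈ Ioo a b) : f x = f y :=
  isOpen_Ioo.is_const_of_deriv_eq_zero isPreconnected_Ioo
    (fun z hz => (hf z hz).differentiableAt.differentiableWithinAt)
    (fun z hz => (hf z hz).deriv) hx hy

theorem MemW.tendsto_comp {ι : Type*} {l : Filter ι} [l.NeBot] (hw : MemW α w) {f : ι → ℝ × ℝ}
    {p : ℝ × ℝ} (hf : Tendsto f l (𝓝 p)) (hmem : ∀ᶠ i in l, f i ∈ Omega) :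
    Tendsto (fun i => w (f i)) l (𝓝 (w p)) := by
  have hp : p ∈ closure Omega := mem_closure_of_tendsto hf hmem
  exact (hw.continuousOn p hp).tendsto.comp
    (tendsto_nhdsWithin_iff.2 ⟨hf, hmem.mono fun _ h => subset_closure h⟩)

/-- Iterated one-variable derivatives are rewritten through the second Fréchet derivative, whose
symmetry cancels the mixed terms in characteristic coordinates. -/
theorem partialX_partialX_eq_fderiv {p : ℝ × ℝ} (hw : ContDiffAt ℝ 2 w p) :
    partialX (partialX w) p = fderiv ℝ (fderiv ℝ w) p (1, 0) (1, 0) := by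
  have hl : ∀ s, HasDerivAt (fun s : ℝ => (s, p.2)) ((1 : ℝ), (0 : ℝ)) s := fun s =>
    (hasDerivAt_id s).prodMk (hasDerivAt_const s p.2)
  have hc : Tendsto (fun s : ℝ => (s, p.2)) (𝓝 p.1) (𝓝 p) :=
    (by fun_prop : Continuous fun s : ℝ => (s, p.2)).tendsto' _ _ rfl
  have h1 : (fun s => partialX w (s, p.2)) =ᶠ[𝓝 p.1] fun s => fderiv ℝ w (s, p.2) (1, 0) := by
    filter_upwards [hc.eventually (hw.eventually (by simp))] with s hs
    exact ((hs.differentiableAt (by simp)).hasFDerivAt.comp_hasDerivAt s (hl s)).deriv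
  have h2 : HasFDerivAt (fderiv ℝ w) (fderiv ℝ (fderiv ℝ w) p) p :=
    ((hw.fderiv_right (m := 1) (by norm_num)).differentiableAt (by simp)).hasFDerivAt
  have h3 := (HasFDerivAt.comp_hasDerivAt (f := fun s : ℝ => (s, p.2)) p.1 h2 (hl p.1)).clm_apply
    (hasDerivAt_const p.1 ((1 : ℝ), (0 : ℝ)))
  rw [partialX, h1.deriv_eq]
  simpa using h3.deriv

theorem partialY_partialY_eq_fderiv {p : ℝ × ℝ} (hw : ContDiffAt ℝ 2 w p) :
    partialY (partialY w) p = fderiv ℝ (fderiv ℝ w) p (0, 1) (0, 1) := by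
  have hl : ∀ s, HasDerivAt (fun s : ℝ => (p.1, s)) ((0 : ℝ), (1 : ℝ)) s := fun s =>
    (hasDerivAt_const s p.1).prodMk (hasDerivAt_id s)
  have hc : Tendsto (fun s : ℝ => (p.1, s)) (𝓝 p.2) (𝓝 p) :=
    (by fun_prop : Continuous fun s : ℝ => (p.1, s)).tendsto' _ _ rfl
  have h1 : (fun s => partialY w (p.1, s)) =ᶠ[𝓝 p.2] fun s => fderiv ℝ w (p.1, s) (0, 1) := by
    filter_upwards [hc.eventually (hw.eventually (by simp))] with s hs
    exact ((hs.differentiableAt (by simp)).hasFDerivAt.comp_hasDerivAt s (hl s)).deriv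
  have h2 : HasFDerivAt (fderiv ℝ w) (fderiv ℝ (fderiv ℝ w) p) p :=
    ((hw.fderiv_right (m := 1) (by norm_num)).differentiableAt (by simp)).hasFDerivAt
  have h3 := (HasFDerivAt.comp_hasDerivAt (f := fun s : ℝ => (p.1, s)) p.2 h2 (hl p.2)).clm_apply
    (hasDerivAt_const p.2 ((0 : ℝ), (1 : ℝ)))
  rw [partialY, h1.deriv_eq]
  simpa using h3.deriv

/-- The point of `OmegaMinus` with characteristic coordinates `ξ = x + y`, `η = x - y`. -/
noncomputable def charPoint (ξ η : ℝ) : ℝ × ℝ := ((ξ + η) / 2, (ξ - η) / 2)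

theorem charPoint_mem {ξ η : ℝ} (h0 : 0 < ξ) (h1 : ξ < η) (h2 : η < 1) :
    charPoint ξ η ∈ OmegaMinus := by
  simp only [charPoint, OmegaMinus, mem_ofPred_eq]
  refine ⟨?_, ?_, ?_, ?_⟩ <;> linarith

theorem OmegaMinus_subset_Omega : OmegaMinus ⊆ Omega := fun _ hp => Or.inl (Or.inr hp)

theorem hasDerivAt_charPoint_left (ξ η : ℝ) :
    HasDerivAt (fun s => charPoint s η) ((1 / 2 : ℝ), (1 / 2 : ℝ)) ξ :=
  (((hasDerivAt_id ξ).add_const η).div_const 2).prodMk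
    (((hasDerivAt_id ξ).sub_const η).div_const 2)

theorem hasDerivAt_charPoint_right (ξ η : ℝ) :
    HasDerivAt (fun s => charPoint ξ s) ((1 / 2 : ℝ), (-1 / 2 : ℝ)) η :=
  (((hasDerivAt_id η).const_add ξ).div_const 2).prodMk
    (((hasDerivAt_id η).const_sub ξ).div_const 2)

/-- D'Alembert: a solution of the wave equation that vanishes on the characteristic `x = -y`
depends on `x + y` only. -/
theorem eq_trace_of_wave (hw : MemW α w)
    (heq : ∀ p ∈ OmegaMinus, partialX (partialX w) p - partialY (partialY w) p = 0)
    (hchar : ∀ x ∈ Icc (0 : ℝ) (1 / 2), w (x, -x) = 0) {p : ℝ × ℝ} (hp : p ∈ OmegaMinus) :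
    w p = w (p.1 + p.2, 0) := by
  -- In characteristic coordinates `w_ξη = (w_xx - w_yy) / 4 = 0`, so `w_ξ` does not depend on `η`.
  have hA : ∀ ξ η₁ η₂, 0 < ξ → η₁ ∈ Ioo ξ 1 → η₂ ∈ Ioo ξ 1 →
      fderiv ℝ w (charPoint ξ η₁) (1 / 2, 1 / 2) = fderiv ℝ w (charPoint ξ η₂) (1 / 2, 1 / 2) := by
    intro ξ η₁ η₂ hξ h1 h2
    refine eq_of_hasDerivAt_zero_Ioo
      (f := fun η => fderiv ℝ w (charPoint ξ η) ((1 / 2 : ℝ), (1 / 2 : ℝ))) (fun η hη => ?_) h1 h2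
    have hmem := charPoint_mem hξ hη.1 hη.2
    have hc := hw.contDiffAt hmem
    have hD : HasFDerivAt (fderiv ℝ w) (fderiv ℝ (fderiv ℝ w) (charPoint ξ η)) (charPoint ξ η) :=
      ((hc.fderiv_right (m := 1) (by norm_num)).differentiableAt (by simp)).hasFDerivAt
    have h3 := (HasFDerivAt.comp_hasDerivAt η hD (hasDerivAt_charPoint_right ξ η)).clm_apply
      (hasDerivAt_const η ((1 / 2 : ℝ), (1 / 2 : ℝ)))
    refine h3.congr_deriv ?_
    have hs := hc.isSymmSndFDerivAt (by simp) ((1 : ℝ), (0 : ℝ)) ((0 : ℝ), (1 : ℝ))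
    have he := heq _ hmem
    rw [partialX_partialX_eq_fderiv hc, partialY_partialY_eq_fderiv hc] at he
    have e1 : ((1 / 2 : ℝ), (1 / 2 : ℝ))
        = (1 / 2 : ℝ) • ((1 : ℝ), (0 : ℝ)) + (1 / 2 : ℝ) • ((0 : ℝ), (1 : ℝ)) := by simp
    have e2 : ((1 / 2 : ℝ), (-1 / 2 : ℝ))
        = (1 / 2 : ℝ) • ((1 : ℝ), (0 : ℝ)) + (-1 / 2 : ℝ) • ((0 : ℝ), (1 : ℝ)) := by simp
    rw [e1, e2]
    simp only [map_add, map_smul, add_apply, smul_apply, map_zero, smul_eq_mul, add_zero]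
    linarith
  -- The difference of the values at `η₂` and `η₁` is thus constant in `ξ`; letting `ξ → 0+` reaches
  -- the characteristic, where `w = 0`.
  have hB : ∀ ξ η₁ η₂, 0 < ξ → ξ < η₁ → η₁ < η₂ → η₂ < 1 →
      w (charPoint ξ η₂) = w (charPoint ξ η₁) := by
    intro ξ η₁ η₂ h0 h1 h2 h3
    have hder : ∀ s ∈ Ioo 0 η₁,
        HasDerivAt (fun s => w (charPoint s η₂) - w (charPoint s η₁)) 0 s := by
      intro s hs
      have d : ∀ η, s < η → η < 1 → HasDerivAt (fun s => w (charPoint s η))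
          (fderiv ℝ w (charPoint s η) ((1 / 2 : ℝ), (1 / 2 : ℝ))) s := fun η h h' =>
        HasFDerivAt.comp_hasDerivAt s
          ((hw.contDiffAt (charPoint_mem hs.1 h h')).differentiableAt (by simp)).hasFDerivAt
          (hasDerivAt_charPoint_left s η)
      refine ((d η₂ (hs.2.trans h2) h3).sub (d η₁ hs.2 (h2.trans h3))).congr_deriv ?_
      rw [hA s η₂ η₁ hs.1 ⟨hs.2.trans h2, h3⟩ ⟨hs.2, h2.trans h3⟩, sub_self]
    have hlim : ∀ η, 0 < η → η < 1 →
        Tendsto (fun s => w (charPoint s η)) (𝓝[>] 0) (𝓝 0) := by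
      intro η h h'
      have hz : w (charPoint 0 η) = 0 := by
        have := hchar (η / 2) ⟨by linarith, by linarith⟩
        have e : charPoint 0 η = (η / 2, -(η / 2)) := by ext <;> simp only [charPoint] <;> ring
        rw [e, this]
      suffices hmem : ∀ᶠ s in 𝓝[>] (0 : ℝ), charPoint s η ∈ Omega by
        have := hw.tendsto_comp
          ((hasDerivAt_charPoint_left 0 η).continuousAt.tendsto.mono_left nhdsWithin_le_nhds) hmem
        rwa [hz] at this
      filter_upwards [Ioo_mem_nhdsGT h] with s hs
      exact OmegaMinus_subset_Omega (charPoint_mem hs.1 hs.2 h')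
    have hl := (hlim η₂ (by linarith) h3).sub (hlim η₁ (by linarith) (by linarith))
    have hconst : Tendsto (fun s => w (charPoint s η₂) - w (charPoint s η₁)) (𝓝[>] 0)
        (𝓝 (w (charPoint ξ η₂) - w (charPoint ξ η₁))) := by
      refine tendsto_const_nhds.congr' ?_
      filter_upwards [Ioo_mem_nhdsGT (h0.trans h1)] with s hs
      exact eq_of_hasDerivAt_zero_Ioo
        (f := fun s => w (charPoint s η₂) - w (charPoint s η₁)) hder ⟨h0, h1⟩ hs
    have := tendsto_nhds_unique hconst hl
    linarith
  obtain ⟨h1, h2, h3, h4⟩ := hp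
  have hpe : p = charPoint (p.1 + p.2) (p.1 - p.2) := by
    ext <;> simp only [charPoint] <;> ring
  have h0 : 0 < p.1 + p.2 := by linarith
  have hlt : p.1 + p.2 < p.1 - p.2 := by linarith
  -- As `η` decreases to `ξ = x + y`, the point reaches `(ξ, 0)` on `AB`.
  have hl : Tendsto (fun η => w (charPoint (p.1 + p.2) η)) (𝓝[>] (p.1 + p.2))
      (𝓝 (w (charPoint (p.1 + p.2) (p.1 + p.2)))) := by
    refine hw.tendsto_comp ((hasDerivAt_charPoint_right _ _).continuousAt.tendsto.mono_left
      nhdsWithin_le_nhds) ?_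
    filter_upwards [Ioo_mem_nhdsGT hlt] with s hs
    exact OmegaMinus_subset_Omega (charPoint_mem h0 hs.1 (by linarith [hs.2]))
  have hconst : Tendsto (fun η => w (charPoint (p.1 + p.2) η)) (𝓝[>] (p.1 + p.2)) (𝓝 (w p)) := by
    refine tendsto_const_nhds.congr' ?_
    filter_upwards [Ioo_mem_nhdsGT hlt] with s hs
    rw [← hB _ _ _ h0 hs.1 hs.2 (by linarith), ← hpe]
  have := tendsto_nhds_unique hconst hl
  rw [this, charPoint]
  congr 2 <;> ring

/-- The trace on `AB` inherits the regularity of `w` in `OmegaMinus`. -/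
theorem contDiffAt_trace (hw : MemW α w) (htr : ∀ p ∈ OmegaMinus, w p = w (p.1 + p.2, 0)) {s : ℝ}
    (hs : s ∈ Ioo (0 : ℝ) 1) : ContDiffAt ℝ 2 (fun x => w (x, 0)) s := by
  obtain ⟨h0, h1⟩ := hs
  -- Sliding `(r, 0)` along the line `x + y = r` to the fixed height `-(1 - s) / 4` brings it into
  -- the open triangle for all `r` near `s`.
  have hmem : ∀ r ∈ Ioo 0 ((1 + s) / 2), (r + (1 - s) / 4, -((1 - s) / 4)) ∈ OmegaMinus := by
    intro r hr
    simp only [OmegaMinus, mem_ofPred_eq]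
    refine ⟨?_, ?_, ?_, ?_⟩ <;> linarith [hr.1, hr.2]
  have hs' : s ∈ Ioo 0 ((1 + s) / 2) := ⟨h0, by linarith⟩
  have hc : ContDiffAt ℝ 2 (fun r => w (r + (1 - s) / 4, -((1 - s) / 4))) s :=
    ContDiffAt.comp (f := fun r : ℝ => (r + (1 - s) / 4, -((1 - s) / 4))) s
      (hw.contDiffAt (hmem s hs')) (by fun_prop)
  refine hc.congr_of_eventuallyEq ?_
  filter_upwards [Ioo_mem_nhds hs'.1 hs'.2] with r hr
  rw [htr _ (hmem r hr)]
  simp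

/-- Below `AB` one has `w_y (x, y) = τ' (x + y)`, and `τ'` is continuous at `x`. -/
theorem tendsto_partialY_trace (hw : MemW α w)
    (htr : ∀ p ∈ OmegaMinus, w p = w (p.1 + p.2, 0)) {x : ℝ} (hx : x ∈ Ioo (0 : ℝ) 1) :
    Tendsto (fun y => partialY w (x, y)) (𝓝[<] 0) (𝓝 (deriv (fun s => w (s, 0)) x)) := by
  have hc : ContinuousAt (deriv fun s => w (s, 0)) x :=
    (differentiableAt_deriv_of_contDiffAt_two (contDiffAt_trace hw htr hx)).continuousAt
  have hl : Tendsto (fun y : ℝ => x + y) (𝓝[<] 0) (𝓝 x) :=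
    ((continuous_const.add continuous_id).tendsto' 0 x (by simp)).mono_left nhdsWithin_le_nhds
  refine (hc.tendsto.comp hl).congr' ?_
  filter_upwards [eventually_mem_OmegaMinus hx] with y hy
  have he : (fun s => w (x, s)) =ᶠ[𝓝 y] fun s => w (x + s, 0) := by
    have ho : ∀ᶠ s in 𝓝 y, (x, s) ∈ OmegaMinus :=
      (by fun_prop : Continuous fun s : ℝ => (x, s)).continuousAt.eventually
        (isOpen_OmegaMinus.mem_nhds hy)
    filter_upwards [ho] with s hs using htr _ hs
  simp only [partialY, Function.comp]
  rw [he.deriv_eq, deriv_comp_const_add (f := fun s => w (s, 0))]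

end TricomiCaputo

/-! ### The limit of the Caputo derivative as `y → 0+`. -/

namespace TricomiCaputo

variable {α : ℝ}

/-- The kernel of the Caputo derivative applied to the derivative `t ^ (α - 1)`. -/
noncomputable def betaKernel (α y t : ℝ) : ℝ := (y - t) ^ (-α) * t ^ (α - 1)

theorem betaKernel_pos {y t : ℝ} (ht : t ∈ Ioo 0 y) : 0 < betaKernel α y t :=
  mul_pos (Real.rpow_pos_of_pos (sub_pos.2 ht.2) _) (Real.rpow_pos_of_pos ht.1 _)

/-- On `(0, 1)` the kernel is the norm of the integrand of the complex Beta integral with parameters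
`α` and `1 - α`. -/
theorem intervalIntegrable_betaKernel_one (h0 : 0 < α) (h1 : α < 1) :
    IntervalIntegrable (betaKernel α 1) volume 0 1 := by
  have h := (Complex.betaIntegral_convergent (u := (α : ℂ)) (v := ((1 - α : ℝ) : ℂ)) (by simpa)
    (by simpa using h1)).norm
  refine h.congr_uIoo fun t ht => ?_
  rw [uIoo_of_le zero_le_one] at ht
  have e : (1 - (t : ℂ)) = ((1 - t : ℝ) : ℂ) := by simp
  simp only [betaKernel]
  rw [norm_mul, e, Complex.norm_cpow_eq_rpow_re_of_pos ht.1,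
    Complex.norm_cpow_eq_rpow_re_of_pos (sub_pos.2 ht.2), mul_comm]
  simp

/-- The kernel is homogeneous of degree `-1`, which makes its integral over `(0, y)` independent of
`y`. -/
theorem betaKernel_mul {y s : ℝ} (hy : 0 < y) (hs : s ∈ Ioo (0 : ℝ) 1) :
    betaKernel α y (y * s) = y⁻¹ * betaKernel α 1 s := by
  have e : y - y * s = y * (1 - s) := by ring
  have e2 : y⁻¹ = y ^ (-α) * y ^ (α - 1) := by
    rw [← Real.rpow_add hy, ← Real.rpow_neg_one]; congr 1; ring
  rw [betaKernel, betaKernel, e, Real.mul_rpow hy.le (sub_pos.2 hs.2).le,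
    Real.mul_rpow hy.le hs.1.le, e2]
  ring

theorem intervalIntegrable_betaKernel (h0 : 0 < α) (h1 : α < 1) {y : ℝ} (hy : 0 < y) :
    IntervalIntegrable (betaKernel α y) volume 0 y := by
  have h : IntervalIntegrable (fun s => betaKernel α y (y * s)) volume 0 1 := by
    refine ((intervalIntegrable_betaKernel_one h0 h1).const_mul y⁻¹).congr_uIoo fun s hs => ?_
    rw [uIoo_of_le zero_le_one] at hs
    exact (betaKernel_mul hy hs).symm
  have := (IntervalIntegrable.comp_mul_left_iff (f := betaKernel α y) (a := 0) (b := y) hy.ne').1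
    (by simpa [hy.ne'] using h)
  exact this

theorem integral_betaKernel {y : ℝ} (hy : 0 < y) :
    ∫ t in (0 : ℝ)..y, betaKernel α y t = ∫ s in (0 : ℝ)..1, betaKernel α 1 s := by
  have h := intervalIntegral.mul_integral_comp_mul_left (f := betaKernel α y) (a := 0) (b := 1) y
  rw [mul_zero, mul_one] at h
  have h2 : ∫ s in (0 : ℝ)..1, betaKernel α y (y * s)
      = ∫ s in (0 : ℝ)..1, y⁻¹ * betaKernel α 1 s := by
    refine intervalIntegral.integral_congr_uIoo fun s hs => ?_
    rw [uIoo_of_le zero_le_one] at hs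
    exact betaKernel_mul hy hs
  rw [← h, h2, intervalIntegral.integral_const_mul, mul_inv_cancel_left₀ hy.ne']

/-- The value of the Caputo derivative of a function with derivative `t ^ (α - 1)`. -/
noncomputable def caputoConst (α : ℝ) : ℝ :=
  1 / Real.Gamma (1 - α) * ∫ s in (0 : ℝ)..1, betaKernel α 1 s

theorem caputoConst_pos (h0 : 0 < α) (h1 : α < 1) : 0 < caputoConst α := by
  refine mul_pos (one_div_pos.2 (Real.Gamma_pos_of_pos (by linarith))) ?_
  exact intervalIntegral.intervalIntegral_pos_of_pos_on (intervalIntegrable_betaKernel_one h0 h1)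
    (fun t ht => betaKernel_pos ht) one_pos

/-- The integrand is `betaKernel α y t` times `t ^ (1 - α) * deriv f t`, and the latter is uniformly
close to `m` on `(0, y)` for small `y`. As the kernel has the same mass `B` for every `y`, closeness
`ε / (2 * B)` gives an error of at most `ε / 2`. -/
theorem tendsto_caputo (h0 : 0 < α) (h1 : α < 1) {f : ℝ → ℝ} {m : ℝ}
    (hf : ∀ y ∈ Ioo (0 : ℝ) 1, HasCaputo α f y)
    (hm : Tendsto (fun y => y ^ (1 - α) * deriv f y) (𝓝[>] 0) (𝓝 m)) :
    Tendsto (caputo α f) (𝓝[>] 0) (𝓝 (caputoConst α * m)) := by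
  set B := ∫ s in (0 : ℝ)..1, betaKernel α 1 s with hB
  have hBpos : 0 < B := intervalIntegral.intervalIntegral_pos_of_pos_on
    (intervalIntegrable_betaKernel_one h0 h1) (fun t ht => betaKernel_pos ht) one_pos
  suffices h : Tendsto (fun y => ∫ t in (0 : ℝ)..y, (y - t) ^ (-α) * deriv f t) (𝓝[>] 0)
      (𝓝 (B * m)) by
    have := h.const_mul (1 / Real.Gamma (1 - α))
    rw [← mul_assoc] at this
    exact this
  rw [Metric.tendsto_nhds] at hm ⊢
  intro ε hε
  obtain ⟨δ, hδ, hδε⟩ := mem_nhdsGT_iff_exists_Ioo_subset.1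
    (hm (ε / (2 * B)) (by positivity))
  filter_upwards [Ioo_mem_nhdsGT one_pos, Ioo_mem_nhdsGT (mem_Ioi.1 hδ)] with y hy1 hyδ
  have hk := intervalIntegrable_betaKernel h0 h1 hy1.1
  have hi : (∫ t in (0 : ℝ)..y, (y - t) ^ (-α) * deriv f t) - B * m
      = ∫ t in (0 : ℝ)..y, ((y - t) ^ (-α) * deriv f t - betaKernel α y t * m) := by
    rw [intervalIntegral.integral_sub (hf y hy1).2 (hk.mul_const m),
      intervalIntegral.integral_mul_const, integral_betaKernel hy1.1]
  have hb : ‖∫ t in (0 : ℝ)..y, ((y - t) ^ (-α) * deriv f t - betaKernel α y t * m)‖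
      ≤ ∫ t in (0 : ℝ)..y, betaKernel α y t * (ε / (2 * B)) := by
    refine intervalIntegral.norm_integral_le_of_norm_le hy1.1.le ?_ (hk.mul_const _)
    have hne : ∀ᵐ t : ℝ, t ≠ y := by simp [ae_iff]
    filter_upwards [hne] with t hty ht
    have ht' : t ∈ Ioo 0 y := ⟨ht.1, lt_of_le_of_ne ht.2 hty⟩
    have hd : dist (t ^ (1 - α) * deriv f t) m < ε / (2 * B) :=
      hδε ⟨ht.1, ht'.2.trans hyδ.2⟩
    have e1 : t ^ (α - 1) * t ^ (1 - α) = 1 := by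
      rw [← Real.rpow_add ht.1]; simp
    have e : (y - t) ^ (-α) * deriv f t - betaKernel α y t * m
        = betaKernel α y t * (t ^ (1 - α) * deriv f t - m) := by
      rw [betaKernel]
      linear_combination (-(y - t) ^ (-α) * deriv f t) * e1
    rw [e, norm_mul, Real.norm_of_nonneg (betaKernel_pos ht').le]
    exact mul_le_mul_of_nonneg_left hd.le (betaKernel_pos ht').le
  rw [dist_eq_norm, hi]
  refine hb.trans_lt ?_
  rw [intervalIntegral.integral_mul_const, integral_betaKernel hy1.1, ← hB]
  field_simp
  linarith

end TricomiCaputo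

/-! ### Pointwise limits of second derivatives. -/

namespace TricomiCaputo

/-- A pointwise bounded sequence of continuous functions is uniformly bounded on some
subinterval. -/
theorem exists_Icc_uniform_bound {g : ℕ → ℝ → ℝ} {a b : ℝ} (hab : a < b)
    (hg : ∀ n, ContinuousOn (g n) (Icc a b)) (hb : ∀ x ∈ Ioo a b, ∃ M : ℝ, ∀ n, |g n x| ≤ M) :
    ∃ c d M : ℝ, c < d ∧ Icc c d ⊆ Ioo a b ∧ ∀ n, ∀ x ∈ Icc c d, |g n x| ≤ M := by
  -- Adjoining the complement of `Ioo a b` makes the closed sets cover all of `ℝ`, so Baire's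
  -- theorem applies there.
  let E : ℕ → Set ℝ := fun N => (⋂ n, Icc a b ∩ g n ⁻¹' Icc (-(N : ℝ)) N) ∪ (Ioo a b)ᶜ
  have hE : ∀ N, IsClosed (E N) := fun N =>
    (isClosed_iInter fun n => (hg n).preimage_isClosed_of_isClosed isClosed_Icc isClosed_Icc).union
      isOpen_Ioo.isClosed_compl
  have hU : ⋃ N, E N = univ := by
    refine eq_univ_of_forall fun x => mem_iUnion.2 ?_
    by_cases hx : x ∈ Ioo a b
    · obtain ⟨M, hM⟩ := hb x hx
      obtain ⟨N, hN⟩ := exists_nat_ge M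
      exact ⟨N, Or.inl (mem_iInter.2 fun n =>
        ⟨Ioo_subset_Icc_self hx, abs_le.1 ((hM n).trans hN)⟩)⟩
    · exact ⟨0, Or.inr hx⟩
  obtain ⟨x, hx, hxU⟩ := (dense_iUnion_interior_of_closed hE hU).inter_open_nonempty _ isOpen_Ioo
    (nonempty_Ioo.2 hab)
  obtain ⟨N, hN⟩ := mem_iUnion.1 hxU
  obtain ⟨ε, hε, hball⟩ := Metric.isOpen_iff.1 (isOpen_Ioo.inter (isOpen_interior (s := E N))) x
    ⟨hx, hN⟩
  have hsub : Icc (x - ε / 2) (x + ε / 2) ⊆ Ioo a b ∩ interior (E N) := by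
    intro z hz
    refine hball ?_
    rw [Metric.mem_ball, Real.dist_eq, abs_lt]
    constructor <;> linarith [hz.1, hz.2]
  refine ⟨x - ε / 2, x + ε / 2, N, by linarith, fun z hz => (hsub hz).1, fun n z hz => ?_⟩
  rcases interior_subset (hsub hz).2 with h | h
  · exact abs_le.2 (mem_iInter.1 h n).2
  · exact absurd (hsub hz).1 h

/-- Integration by parts against a test function with double zeros at the ends. -/
theorem integral_mul_test_eq {f f' f'' : ℝ → ℝ} {c d : ℝ} (hcd : c ≤ d)
    (hf : ∀ x ∈ Icc c d, HasDerivAt f (f' x) x) (hf' : ∀ x ∈ Icc c d, HasDerivAt f' (f'' x) x)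
    (hc : ContinuousOn f'' (Icc c d)) :
    ∫ x in c..d, f'' x * ((x - c) ^ 2 * (d - x) ^ 2) =
      ∫ x in c..d, f x * (2 * (d - x) ^ 2 - 8 * (x - c) * (d - x) + 2 * (x - c) ^ 2) := by
  have hcf : ContinuousOn f (Icc c d) := fun x hx => (hf x hx).continuousAt.continuousWithinAt
  have i1 : IntervalIntegrable (fun x => f'' x * ((x - c) ^ 2 * (d - x) ^ 2)) volume c d :=
    ContinuousOn.intervalIntegrable_of_Icc hcd (by fun_prop)
  have i2 : IntervalIntegrable
      (fun x => f x * (2 * (d - x) ^ 2 - 8 * (x - c) * (d - x) + 2 * (x - c) ^ 2)) volume c d :=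
    ContinuousOn.intervalIntegrable_of_Icc hcd (by fun_prop)
  rw [← sub_eq_zero, ← intervalIntegral.integral_sub i1 i2]
  rw [intervalIntegral.integral_eq_sub_of_hasDerivAt
    (f := fun x => f' x * ((x - c) ^ 2 * (d - x) ^ 2) -
      f x * (2 * (x - c) * (d - x) ^ 2 - 2 * (x - c) ^ 2 * (d - x))) _ (i1.sub i2)]
  · ring
  · intro x hx
    rw [uIcc_of_le hcd] at hx
    have p : HasDerivAt (fun x => x - c) 1 x := (hasDerivAt_id x).sub_const c
    have q : HasDerivAt (fun x => d - x) (-1) x := (hasDerivAt_id x).const_sub d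
    have h1 := (hf' x hx).mul ((p.pow 2).mul (q.pow 2))
    have h2 := (hf x hx).mul
      (((p.const_mul 2).mul (q.pow 2)).sub (((p.pow 2).const_mul 2).mul q))
    refine ((h1.sub h2).congr_deriv ?_)
    simp only [Pi.mul_apply, Pi.pow_apply, Pi.sub_apply]
    push_cast
    ring

/-- If `f n → f` boundedly, and the second derivatives of the `f n` converge just pointwise, then
their limit is `f''`, provided that it is continuous and that `f` is of class `C²`. -/
theorem second_deriv_eq_of_tendsto {f f' f'' : ℕ → ℝ → ℝ} {τ τ' τ'' h : ℝ → ℝ} {a b C : ℝ}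
    (hf : ∀ n, ∀ x ∈ Ioo a b, HasDerivAt (f n) (f' n x) x)
    (hf' : ∀ n, ∀ x ∈ Ioo a b, HasDerivAt (f' n) (f'' n x) x)
    (hf'' : ∀ n, ContinuousOn (f'' n) (Ioo a b))
    (hC : ∀ n, ∀ x ∈ Ioo a b, |f n x| ≤ C)
    (hlim : ∀ x ∈ Ioo a b, Tendsto (fun n => f n x) atTop (𝓝 (τ x)))
    (hlim'' : ∀ x ∈ Ioo a b, Tendsto (fun n => f'' n x) atTop (𝓝 (h x)))
    (hτ : ∀ x ∈ Ioo a b, HasDerivAt τ (τ' x) x) (hτ' : ∀ x ∈ Ioo a b, HasDerivAt τ' (τ'' x) x)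
    (hτ'' : ContinuousOn τ'' (Ioo a b)) (hh : ContinuousOn h (Ioo a b)) {x : ℝ}
    (hx : x ∈ Ioo a b) : τ'' x = h x := by
  by_contra hne
  -- Multiplying by `k` treats both signs of the difference at once.
  set k := τ'' x - h x with hk
  have hk0 : k ≠ 0 := sub_ne_zero.2 hne
  have hcont : ContinuousAt (fun z => k * (τ'' z - h z)) x :=
    ContinuousOn.continuousAt (s := Ioo a b) (by fun_prop) (isOpen_Ioo.mem_nhds hx)
  have hpos : ∀ᶠ z in 𝓝 x, 0 < k * (τ'' z - h z) ∧ z ∈ Ioo a b :=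
    (hcont.eventually (lt_mem_nhds (mul_self_pos.2 hk0))).and (isOpen_Ioo.mem_nhds hx)
  obtain ⟨ε, hε, hball⟩ := Metric.eventually_nhds_iff.1 hpos
  have hsub : ∀ z ∈ Icc (x - ε / 2) (x + ε / 2), 0 < k * (τ'' z - h z) ∧ z ∈ Ioo a b := by
    intro z hz
    refine hball ?_
    rw [Real.dist_eq, abs_lt]
    constructor <;> linarith [hz.1, hz.2]
  -- On a subinterval the pointwise convergent `f'' n` are uniformly bounded, as dominated
  -- convergence requires.
  obtain ⟨c, d, M, hcd, hcds, hM⟩ := exists_Icc_uniform_bound (g := f'')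
    (show x - ε / 2 < x + ε / 2 by linarith)
    (fun n => (hf'' n).mono fun z hz => (hsub z hz).2) (fun z hz => by
      obtain ⟨M, hM⟩ := (hlim'' z (hsub z (Ioo_subset_Icc_self hz)).2).abs.bddAbove_range
      exact ⟨M, fun n => hM (mem_range_self n)⟩)
  have hI : ∀ z ∈ Icc c d, z ∈ Ioo a b := fun z hz => (hsub z (Ioo_subset_Icc_self (hcds hz))).2
  have hcf : ∀ n, ContinuousOn (f n) (Icc c d) := fun n z hz =>
    (hf n z (hI z hz)).continuousAt.continuousWithinAt
  have hcf'' : ∀ n, ContinuousOn (f'' n) (Icc c d) := fun n => (hf'' n).mono hI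
  have hΙ : uIoc c d ⊆ Icc c d := by rw [uIoc_of_le hcd.le]; exact Ioc_subset_Icc_self
  have l1 : Tendsto (fun n => ∫ z in c..d, f'' n z * ((z - c) ^ 2 * (d - z) ^ 2)) atTop
      (𝓝 (∫ z in c..d, h z * ((z - c) ^ 2 * (d - z) ^ 2))) := by
    refine intervalIntegral.tendsto_integral_filter_of_dominated_convergence
      (fun z => M * ((z - c) ^ 2 * (d - z) ^ 2)) (Eventually.of_forall fun n => ?_)
      (Eventually.of_forall fun n => Eventually.of_forall fun z hz => ?_)
      (Continuous.intervalIntegrable (by fun_prop) _ _) (Eventually.of_forall fun z hz => ?_)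
    · have hc := hcf'' n
      have : ContinuousOn (fun z => f'' n z * ((z - c) ^ 2 * (d - z) ^ 2)) (Icc c d) := by fun_prop
      exact (this.aestronglyMeasurable measurableSet_Icc).mono_measure
        (Measure.restrict_mono hΙ le_rfl)
    · rw [norm_mul, Real.norm_eq_abs, Real.norm_of_nonneg (by positivity)]
      exact mul_le_mul_of_nonneg_right (hM n z (hΙ hz)) (by positivity)
    · exact (hlim'' z (hI z (hΙ hz))).mul_const _
  have l2 : Tendsto (fun n => ∫ z in c..d,
        f n z * (2 * (d - z) ^ 2 - 8 * (z - c) * (d - z) + 2 * (z - c) ^ 2)) atTop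
      (𝓝 (∫ z in c..d, τ z * (2 * (d - z) ^ 2 - 8 * (z - c) * (d - z) + 2 * (z - c) ^ 2))) := by
    refine intervalIntegral.tendsto_integral_filter_of_dominated_convergence
      (fun z => C * |2 * (d - z) ^ 2 - 8 * (z - c) * (d - z) + 2 * (z - c) ^ 2|)
      (Eventually.of_forall fun n => ?_)
      (Eventually.of_forall fun n => Eventually.of_forall fun z hz => ?_)
      (Continuous.intervalIntegrable (by fun_prop) _ _) (Eventually.of_forall fun z hz => ?_)
    · have hc := hcf n
      have : ContinuousOn (fun z => f n z *
        (2 * (d - z) ^ 2 - 8 * (z - c) * (d - z) + 2 * (z - c) ^ 2)) (Icc c d) := by fun_prop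
      exact (this.aestronglyMeasurable measurableSet_Icc).mono_measure
        (Measure.restrict_mono hΙ le_rfl)
    · rw [norm_mul, Real.norm_eq_abs, Real.norm_eq_abs]
      exact mul_le_mul_of_nonneg_right (hC n z (hI z (hΙ hz))) (abs_nonneg _)
    · exact (hlim z (hI z (hΙ hz))).mul_const _
  -- Both derivatives go over to the test function, so the bounded convergence of `f n` identifies
  -- the limit of the integrals of `f'' n`.
  have e := fun n => integral_mul_test_eq hcd.le (fun z hz => hf n z (hI z hz))
    (fun z hz => hf' n z (hI z hz)) (hcf'' n)
  have e' := integral_mul_test_eq hcd.le (fun z hz => hτ z (hI z hz))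
    (fun z hz => hτ' z (hI z hz)) (hτ''.mono hI)
  have heq : ∫ z in c..d, h z * ((z - c) ^ 2 * (d - z) ^ 2)
      = ∫ z in c..d, τ'' z * ((z - c) ^ 2 * (d - z) ^ 2) := by
    rw [e']
    exact tendsto_nhds_unique (l1.congr e) l2
  have hch := hh.mono hI
  have hcτ := hτ''.mono hI
  have i1 : IntervalIntegrable (fun z => τ'' z * ((z - c) ^ 2 * (d - z) ^ 2)) volume c d :=
    ContinuousOn.intervalIntegrable_of_Icc hcd.le (by fun_prop)
  have i2 : IntervalIntegrable (fun z => h z * ((z - c) ^ 2 * (d - z) ^ 2)) volume c d :=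
    ContinuousOn.intervalIntegrable_of_Icc hcd.le (by fun_prop)
  have hgt : 0 < ∫ z in c..d, k * (τ'' z * ((z - c) ^ 2 * (d - z) ^ 2) -
      h z * ((z - c) ^ 2 * (d - z) ^ 2)) := by
    refine intervalIntegral.intervalIntegral_pos_of_pos_on ((i1.sub i2).const_mul k)
      (fun z hz => ?_) hcd
    have h1 := (hsub z (Ioo_subset_Icc_self (hcds (Ioo_subset_Icc_self hz)))).1
    have h2 : 0 < z - c := sub_pos.2 hz.1
    have h3 : 0 < d - z := sub_pos.2 hz.2
    have h4 : k * (τ'' z * ((z - c) ^ 2 * (d - z) ^ 2) - h z * ((z - c) ^ 2 * (d - z) ^ 2))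
      = k * (τ'' z - h z) * ((z - c) ^ 2 * (d - z) ^ 2) := by ring
    rw [h4]
    positivity
  rw [intervalIntegral.integral_const_mul, intervalIntegral.integral_sub i1 i2, heq] at hgt
  simp at hgt

/-! ### The energy argument for the trace. -/

/-- The energy argument: the Dirichlet problem for
`τ'' = A τ' + B (q τ + g ∫ g τ)` with `B, q ≥ 0` has the zero solution only. -/
theorem eq_zero_of_integro_ode {τ τ' τ'' q g S : ℝ → ℝ} {A B : ℝ} (hB : 0 ≤ B)
    (hcτ : ContinuousOn τ (Icc 0 1)) (hτ0 : τ 0 = 0) (hτ1 : τ 1 = 0)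
    (hτ : ∀ x ∈ Ioo (0 : ℝ) 1, HasDerivAt τ (τ' x) x)
    (hτ' : ∀ x ∈ Ioo (0 : ℝ) 1, HasDerivAt τ' (τ'' x) x)
    (hq : ∀ x ∈ Ioo (0 : ℝ) 1, 0 ≤ q x)
    (hS : ∀ x ∈ Ioo (0 : ℝ) 1, HasDerivAt S (g x * τ x) x)
    (hS0 : Tendsto S (𝓝[>] 0) (𝓝 0))
    (heq : ∀ x ∈ Ioo (0 : ℝ) 1, τ'' x = A * τ' x + B * (τ x * q x + g x * S x)) :
    ∀ x ∈ Icc (0 : ℝ) 1, τ x = 0 := by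
  -- The two subtracted squares cancel the cross terms `A τ τ'` and `B g S τ` in `F'`, leaving a sum
  -- of nonnegative terms.
  set F : ℝ → ℝ := fun x => τ x * τ' x - A / 2 * τ x ^ 2 - B / 2 * S x ^ 2 with hFdef
  have hF : ∀ x ∈ Ioo (0 : ℝ) 1, HasDerivAt F (τ' x ^ 2 + B * q x * τ x ^ 2) x := by
    intro x hx
    refine ((((hτ x hx).mul (hτ' x hx)).sub (((hτ x hx).pow 2).const_mul (A / 2))).sub
      (((hS x hx).pow 2).const_mul (B / 2))).congr_deriv ?_
    rw [heq x hx]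
    push_cast
    ring
  have hFmono : MonotoneOn F (Ioo 0 1) := by
    refine monotoneOn_of_deriv_nonneg (convex_Ioo 0 1)
      (fun x hx => (hF x hx).continuousAt.continuousWithinAt)
      (fun x hx => (hF x (interior_subset hx)).differentiableAt.differentiableWithinAt)
      fun x hx => ?_
    have hx' := interior_subset hx
    rw [(hF x hx').deriv]
    have := mul_nonneg (mul_nonneg hB (hq x hx')) (sq_nonneg (τ x))
    positivity
  have hsq : ∀ x ∈ Ioo (0 : ℝ) 1, HasDerivAt (fun x => τ x ^ 2) (2 * (τ x * τ' x)) x := by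
    intro x hx
    refine ((hτ x hx).pow 2).congr_deriv ?_
    push_cast
    ring
  have hl0 : Tendsto τ (𝓝[>] 0) (𝓝 0) := by
    have := (hcτ 0 (by simp)).tendsto
    rw [hτ0] at this
    refine this.mono_left ?_
    rw [← nhdsWithin_Ioo_eq_nhdsGT one_pos]
    exact nhdsWithin_mono _ Ioo_subset_Icc_self
  have hl1 : Tendsto τ (𝓝[<] 1) (𝓝 0) := by
    have := (hcτ 1 (by simp)).tendsto
    rw [hτ1] at this
    refine this.mono_left ?_
    rw [← nhdsWithin_Ioo_eq_nhdsLT zero_lt_one]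
    exact nhdsWithin_mono _ Ioo_subset_Icc_self
  -- Nothing bounds `τ'` near `0`, so a sign argument replaces the boundary value of `F`. If `F x <
  -- 0`, monotonicity together with `τ, S → 0` gives `τ τ' < 0` near `0`; then `τ ^ 2` decreases
  -- from `0`, so `τ` vanishes there, a contradiction.
  have hnonneg : ∀ x ∈ Ioo (0 : ℝ) 1, 0 ≤ F x := by
    intro x hx
    by_contra! hneg
    have hlim : Tendsto (fun z => F x + A / 2 * τ z ^ 2 + B / 2 * S z ^ 2) (𝓝[>] 0) (𝓝 (F x)) := by
      simpa using ((hl0.pow 2).const_mul (A / 2)).const_add (F x) |>.add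
        ((hS0.pow 2).const_mul (B / 2))
    obtain ⟨δ, hδ, hδs⟩ := mem_nhdsGT_iff_exists_Ioo_subset.1
      ((hlim.eventually (gt_mem_nhds hneg)).and (Ioo_mem_nhdsGT hx.1))
    have hδ0 : 0 < δ := hδ
    have hprod : ∀ z ∈ Ioo 0 δ, z ∈ Ioo (0 : ℝ) 1 ∧ τ z * τ' z < 0 := by
      intro z hz
      obtain ⟨h1, h2⟩ := hδs hz
      have hz' : z ∈ Ioo (0 : ℝ) 1 := ⟨hz.1, h2.2.trans hx.2⟩
      have h3 : F z ≤ F x := hFmono hz' hx h2.2.le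
      refine ⟨hz', ?_⟩
      simp only [hFdef] at h1 h3
      linarith
    have hsubI : Icc 0 (δ / 2) ⊆ Icc (0 : ℝ) 1 := by
      intro z hz
      refine ⟨hz.1, ?_⟩
      have := (hprod (δ / 2) ⟨by linarith, by linarith⟩).1.2
      linarith [hz.2]
    have hanti : AntitoneOn (fun x => τ x ^ 2) (Icc 0 (δ / 2)) := by
      refine antitoneOn_of_deriv_nonpos (convex_Icc _ _) ((hcτ.mono hsubI).pow 2) ?_ ?_ <;>
        rw [interior_Icc] <;> intro z hz
      · exact (hsq z (hprod z ⟨hz.1, by linarith [hz.2]⟩).1).differentiableAt.differentiableWithinAt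
      · obtain ⟨h1, h2⟩ := hprod z ⟨hz.1, by linarith [hz.2]⟩
        rw [(hsq z h1).deriv]
        linarith
    have h1 := hanti (a := 0) (b := δ / 2) ⟨le_rfl, by linarith⟩ ⟨by linarith, le_rfl⟩ (by linarith)
    have h2 := (hprod (δ / 2) ⟨by linarith, by linarith⟩).2
    simp only [hτ0] at h1
    have h3 : τ (δ / 2) = 0 := by nlinarith
    rw [h3] at h2
    linarith
  -- The mirror argument at `1`, where `S` need not tend to `0`: since `B ≥ 0`, its term has the
  -- favourable sign and is dropped.
  have hnonpos : ∀ x ∈ Ioo (0 : ℝ) 1, F x ≤ 0 := by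
    intro x hx
    by_contra! hpos
    have hlim : Tendsto (fun z => F x + A / 2 * τ z ^ 2) (𝓝[<] 1) (𝓝 (F x)) := by
      simpa using ((hl1.pow 2).const_mul (A / 2)).const_add (F x)
    obtain ⟨δ, hδ, hδs⟩ := mem_nhdsLT_iff_exists_Ioo_subset.1
      ((hlim.eventually (lt_mem_nhds hpos)).and (Ioo_mem_nhdsLT hx.2))
    have hδ1 : δ < 1 := hδ
    have hprod : ∀ z ∈ Ioo δ 1, z ∈ Ioo (0 : ℝ) 1 ∧ 0 < τ z * τ' z := by
      intro z hz
      obtain ⟨h1, h2⟩ := hδs hz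
      have hz' : z ∈ Ioo (0 : ℝ) 1 := ⟨hx.1.trans h2.1, hz.2⟩
      have h3 : F x ≤ F z := hFmono hx hz' h2.1.le
      have h4 : 0 ≤ B / 2 * S z ^ 2 := by positivity
      refine ⟨hz', ?_⟩
      simp only [hFdef] at h1 h3
      linarith
    have hm : (δ + 1) / 2 ∈ Ioo δ 1 := ⟨by linarith, by linarith⟩
    have hsubI : Icc ((δ + 1) / 2) 1 ⊆ Icc (0 : ℝ) 1 := fun z hz =>
      ⟨(hprod _ hm).1.1.le.trans hz.1, hz.2⟩
    have hmono : MonotoneOn (fun x => τ x ^ 2) (Icc ((δ + 1) / 2) 1) := by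
      refine monotoneOn_of_deriv_nonneg (convex_Icc _ _) ((hcτ.mono hsubI).pow 2) ?_ ?_ <;>
        rw [interior_Icc] <;> intro z hz
      · exact (hsq z (hprod z ⟨by linarith [hz.1], hz.2⟩).1).differentiableAt.differentiableWithinAt
      · obtain ⟨h1, h2⟩ := hprod z ⟨by linarith [hz.1], hz.2⟩
        rw [(hsq z h1).deriv]
        linarith
    have h1 := hmono (a := (δ + 1) / 2) (b := 1) ⟨le_rfl, by linarith⟩ ⟨by linarith, le_rfl⟩
      (by linarith)
    have h2 := (hprod _ hm).2
    simp only [hτ1] at h1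
    have h3 : τ ((δ + 1) / 2) = 0 := by nlinarith
    rw [h3] at h2
    linarith
  have hd : ∀ x ∈ Ioo (0 : ℝ) 1, HasDerivAt τ 0 x := by
    intro x hx
    have hz : F =ᶠ[𝓝 x] fun _ => 0 := by
      filter_upwards [isOpen_Ioo.mem_nhds hx] with z hz
      exact le_antisymm (hnonpos z hz) (hnonneg z hz)
    have h1 : τ' x ^ 2 + B * q x * τ x ^ 2 = 0 := by
      rw [← (hF x hx).deriv, hz.deriv_eq]; simp
    have h2 := mul_nonneg (mul_nonneg hB (hq x hx)) (sq_nonneg (τ x))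
    have h3 : τ' x = 0 := by nlinarith [sq_nonneg (τ' x)]
    rw [← h3]
    exact hτ x hx
  intro x hx
  rcases eq_or_lt_of_le hx.1 with rfl | h0
  · exact hτ0
  rcases eq_or_lt_of_le hx.2 with rfl | h1
  · exact hτ1
  refine tendsto_nhds_unique (tendsto_const_nhds.congr' ?_) hl0
  filter_upwards [Ioo_mem_nhdsGT one_pos] with z hz
  exact eq_of_hasDerivAt_zero_Ioo hd ⟨h0, h1⟩ hz

/-! ### The integral in the gluing condition. -/

theorem hasDerivAt_integral_zero {g : ℝ → ℝ} (hg : ContinuousOn g (Icc 0 1)) {x : ℝ}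
    (hx : x ∈ Ioo (0 : ℝ) 1) : HasDerivAt (fun x => ∫ t in (0 : ℝ)..x, g t) (g x) x := by
  have hg' : ContinuousOn g (Ioo 0 1) := hg.mono Ioo_subset_Icc_self
  exact intervalIntegral.integral_hasDerivAt_right
    ((hg.mono (Icc_subset_Icc_right hx.2.le)).intervalIntegrable_of_Icc hx.1.le)
    (hg'.stronglyMeasurableAtFilter isOpen_Ioo x hx) (hg'.continuousAt (isOpen_Ioo.mem_nhds hx))

theorem tendsto_integral_zero {g : ℝ → ℝ} (hg : ContinuousOn g (Icc 0 1)) :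
    Tendsto (fun x => ∫ t in (0 : ℝ)..x, g t) (𝓝[>] 0) (𝓝 0) := by
  have h := intervalIntegral.continuousOn_primitive_interval (μ := volume) (f := g) (a := 0)
    (b := 1) (by rw [uIcc_of_le zero_le_one]; exact hg.integrableOn_Icc)
  rw [uIcc_of_le zero_le_one] at h
  have h0 := (h 0 (by simp)).tendsto
  rw [intervalIntegral.integral_same] at h0
  refine h0.mono_left ?_
  rw [← nhdsWithin_Ioo_eq_nhdsGT one_pos]
  exact nhdsWithin_mono _ Ioo_subset_Icc_self

/-- The integral in the gluing condition, after integration by parts. -/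
theorem improperIntegral_eq {Q : ℝ → ℝ → ℝ} {Q₁ τ τ' : ℝ → ℝ}
    (hQ : ContinuousOn (fun p : ℝ × ℝ => Q p.1 p.2) {p | 0 ≤ p.2 ∧ p.2 ≤ p.1 ∧ p.1 ≤ 1})
    (hQ₁ : ContinuousOn Q₁ (Icc 0 1))
    (hQt : ∀ x t : ℝ, 0 < t → t < x → x < 1 → HasDerivAt (fun s => Q x s) (-(Q₁ x * Q₁ t)) t)
    (hcτ : ContinuousOn τ (Icc 0 1)) (hτ0 : τ 0 = 0)
    (hτ : ∀ x ∈ Ioo (0 : ℝ) 1, HasDerivAt τ (τ' x) x) {x J : ℝ} (hx : x ∈ Ioo (0 : ℝ) 1) (hJ : HasImproperIntegral (fun t => τ' t * Q x t) x J) :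
    J = τ x * Q x x + Q₁ x * ∫ t in (0 : ℝ)..x, Q₁ t * τ t := by
  obtain ⟨hx0, hx1⟩ := hx
  have hQx : ContinuousOn (fun t => Q x t) (Icc 0 x) :=
    hQ.comp (f := fun t : ℝ => (x, t)) (by fun_prop) fun t ht => ⟨ht.1, ht.2, hx1.le⟩
  have hg : ContinuousOn (fun t => Q₁ t * τ t) (Icc 0 1) := hQ₁.mul hcτ
  have hgi : ∀ z ∈ Icc (0 : ℝ) 1, IntervalIntegrable (fun t => Q₁ t * τ t) volume 0 z :=
    fun z hz => (hg.mono (Icc_subset_Icc_right hz.2)).intervalIntegrable_of_Icc hz.1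
  -- The product `τ * Q x` has derivative `τ' * Q x - Q₁ x * (Q₁ * τ)`; it is integrated over `[ε,
  -- x]` because `τ'` is uncontrolled at `0`.
  have key : ∀ ε ∈ Ioo 0 x, ∫ t in ε..x, τ' t * Q x t = τ x * Q x x - τ ε * Q x ε +
      Q₁ x * ((∫ t in (0 : ℝ)..x, Q₁ t * τ t) - ∫ t in (0 : ℝ)..ε, Q₁ t * τ t) := by
    intro ε hε
    have s1 : Icc ε x ⊆ Icc 0 x := Icc_subset_Icc_left hε.1.le
    have s2 : Icc ε x ⊆ Ioo 0 1 := fun t ht => ⟨hε.1.trans_le ht.1, ht.2.trans_lt hx1⟩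
    have i1 : IntervalIntegrable (fun t => τ' t * Q x t) volume ε x := hJ.1 ε hε
    have i2 : IntervalIntegrable (fun t => Q₁ x * (Q₁ t * τ t)) volume ε x :=
      ((hg.mono (s2.trans Ioo_subset_Icc_self)).intervalIntegrable_of_Icc hε.2.le).const_mul _
    have hftc := intervalIntegral.integral_eq_sub_of_hasDerivAt_of_le
      (f := fun t => τ t * Q x t) (f' := fun t => τ' t * Q x t - Q₁ x * (Q₁ t * τ t)) hε.2.le
      ((hcτ.mono (s2.trans Ioo_subset_Icc_self)).mul (hQx.mono s1))
      (fun t ht => by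
        refine ((hτ t (s2 (Ioo_subset_Icc_self ht))).mul
          (hQt x t (hε.1.trans ht.1) ht.2 hx1)).congr_deriv ?_
        ring) (i1.sub i2)
    rw [intervalIntegral.integral_sub i1 i2, intervalIntegral.integral_const_mul] at hftc
    rw [intervalIntegral.integral_interval_sub_left (hgi x ⟨hx0.le, hx1.le⟩)
      (hgi ε ⟨hε.1.le, (hε.2.trans hx1).le⟩)]
    linarith
  have hle : 𝓝[>] (0 : ℝ) ≤ 𝓝[Icc 0 x] 0 := by
    rw [← nhdsWithin_Ioo_eq_nhdsGT hx0]
    exact nhdsWithin_mono _ Ioo_subset_Icc_self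
  have hl1 : Tendsto τ (𝓝[>] 0) (𝓝 0) := by
    have := ((hcτ.mono (Icc_subset_Icc_right hx1.le)) 0 ⟨le_rfl, hx0.le⟩).tendsto
    rw [hτ0] at this
    exact this.mono_left hle
  have hl2 : Tendsto (fun t => Q x t) (𝓝[>] 0) (𝓝 (Q x 0)) :=
    (hQx 0 ⟨le_rfl, hx0.le⟩).tendsto.mono_left hle
  have hlim : Tendsto (fun ε => τ x * Q x x - τ ε * Q x ε +
      Q₁ x * ((∫ t in (0 : ℝ)..x, Q₁ t * τ t) - ∫ t in (0 : ℝ)..ε, Q₁ t * τ t)) (𝓝[>] 0)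
      (𝓝 (τ x * Q x x + Q₁ x * ∫ t in (0 : ℝ)..x, Q₁ t * τ t)) := by
    simpa using ((hl1.mul hl2).const_sub (τ x * Q x x)).add
      (((tendsto_integral_zero hg).const_sub (∫ t in (0 : ℝ)..x, Q₁ t * τ t)).const_mul (Q₁ x))
  refine tendsto_nhds_unique hJ.2 (hlim.congr' ?_)
  filter_upwards [Ioo_mem_nhdsGT hx0] with ε hε using (key ε hε).symm

end TricomiCaputo

/-! ### The maximum principle in the rectangle. -/

namespace TricomiCaputo

variable {α : ℝ} {w : ℝ × ℝ → ℝ}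

/-- Luchko's inequality: the Caputo derivative at a maximum point is positive if the maximum
exceeds the initial value. -/
theorem caputo_pos_of_isMax (h1 : α < 1) (h0 : 0 < α) {f : ℝ → ℝ} {y : ℝ} (hy : 0 < y)
    (hf : HasCaputo α f y) (hc : ContinuousOn f (Icc 0 y)) (hd : DifferentiableAt ℝ f y)
    (hmax : ∀ t ∈ Icc 0 y, f t ≤ f y) (hlt : f 0 < f y) : 0 < caputo α f y := by
  refine mul_pos (one_div_pos.2 (Real.Gamma_pos_of_pos (by linarith))) ?_
  suffices h : y ^ (-α) * (f y - f 0) ≤ ∫ t in (0 : ℝ)..y, (y - t) ^ (-α) * deriv f t from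
    (mul_pos (Real.rpow_pos_of_pos hy _) (sub_pos.2 hlt)).trans_le h
  have hint : IntegrableOn (fun t => (y - t) ^ (-α) * deriv f t) (Icc 0 y) :=
    (intervalIntegrable_iff_integrableOn_Icc_of_le hy.le).1 hf.2
  have hle : 𝓝[<] y ≤ 𝓝[Icc 0 y] y := by
    rw [← nhdsWithin_Ioo_eq_nhdsLT hy]
    exact nhdsWithin_mono _ Ioo_subset_Icc_self
  have hlim : Tendsto (fun b => ∫ t in (0 : ℝ)..b, (y - t) ^ (-α) * deriv f t) (𝓝[<] y)
      (𝓝 (∫ t in (0 : ℝ)..y, (y - t) ^ (-α) * deriv f t)) := by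
    have h := intervalIntegral.continuousOn_primitive_interval (a := 0) (b := y)
      (by rwa [uIcc_of_le hy.le])
    rw [uIcc_of_le hy.le] at h
    exact (h y ⟨hy.le, le_rfl⟩).tendsto.mono_left hle
  -- Differentiability at `y` makes this boundary term `(y - b) ^ (1 - α)` times a bounded slope, up
  -- to sign, and `α < 1`.
  have hbdry : Tendsto (fun b => (y - b) ^ (-α) * (f b - f y)) (𝓝[<] y) (𝓝 0) := by
    have hs : Tendsto (slope f y) (𝓝[<] y) (𝓝 (deriv f y)) :=
      hd.hasDerivAt.tendsto_slope.mono_left (nhdsWithin_mono _ fun b hb => ne_of_lt hb)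
    have hp : Tendsto (fun b => (y - b) ^ (1 - α)) (𝓝[<] y) (𝓝 0) := by
      have : Continuous fun b => (y - b) ^ (1 - α) :=
        (continuous_const.sub continuous_id).rpow_const fun _ => Or.inr (by linarith)
      exact (this.tendsto' y 0 (by simp [Real.zero_rpow (by linarith : 1 - α ≠ 0)])).mono_left
        nhdsWithin_le_nhds
    have := (hp.mul hs).neg
    rw [zero_mul, neg_zero] at this
    refine this.congr' ?_
    filter_upwards [self_mem_nhdsWithin] with b hb
    have hb' : 0 < y - b := sub_pos.2 hb
    have hb'' : b - y ≠ 0 := by linarith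
    rw [slope_def_field, sub_eq_add_neg 1 α, Real.rpow_add hb', Real.rpow_one]
    field_simp
    ring
  -- The derivative of `(y - t) ^ (-α) * (f t - f y)` is the Caputo integrand plus `α (y - t) ^ (-α
  -- - 1) (f t - f y)`, which is nonpositive by maximality.
  have hineq : ∀ b ∈ Ioo 0 y, (y - b) ^ (-α) * (f b - f y) + y ^ (-α) * (f y - f 0) ≤
      ∫ t in (0 : ℝ)..b, (y - t) ^ (-α) * deriv f t := by
    intro b hb
    have hpos : ∀ t ∈ Icc 0 b, 0 < y - t := fun t ht => by linarith [ht.2, hb.2]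
    have h := intervalIntegral.sub_le_integral_of_hasDeriv_right_of_le
      (g := fun t => (y - t) ^ (-α) * (f t - f y))
      (g' := fun t => (-1 * (-α) * (y - t) ^ (-α - 1)) * (f t - f y) + (y - t) ^ (-α) * deriv f t)
      (φ := fun t => (y - t) ^ (-α) * deriv f t) hb.1.le
      (ContinuousOn.mul (ContinuousOn.rpow_const (by fun_prop) fun t ht => Or.inl (hpos t ht).ne')
        ((hc.mono (Icc_subset_Icc_right hb.2.le)).sub continuousOn_const))
      (fun t ht => by
        have e := ((hasDerivAt_id t).const_sub y).rpow_const (p := -α)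
          (Or.inl (hpos t (Ioo_subset_Icc_self ht)).ne')
        exact (e.mul ((hf.1 t ⟨ht.1, ht.2.trans hb.2⟩).hasDerivAt.sub_const (f y))).hasDerivWithinAt)
      (hint.mono_set (Icc_subset_Icc_right hb.2.le))
      (fun t ht => by
        have e1 : 0 ≤ (y - t) ^ (-α - 1) :=
          Real.rpow_nonneg (hpos t (Ioo_subset_Icc_self ht)).le _
        have e2 : f t - f y ≤ 0 := sub_nonpos.2 (hmax t ⟨ht.1.le, (ht.2.trans hb.2).le⟩)
        have e3 := mul_nonpos_of_nonneg_of_nonpos (mul_nonneg h0.le e1) e2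
        linarith)
    simp only [sub_zero] at h
    linarith
  refine le_of_tendsto_of_tendsto ?_ hlim
    (eventually_of_mem (Ioo_mem_nhdsLT hy) hineq)
  simpa using hbdry.add_const (y ^ (-α) * (f y - f 0))

/-- A positive second derivative would make `x` a local minimum as well, so `f` would be locally
constant and its second derivative zero. -/
theorem deriv_deriv_nonpos_of_isLocalMax {f : ℝ → ℝ} {x : ℝ} (hmax : IsLocalMax f x)
    (hc : ContinuousAt f x) : deriv (deriv f) x ≤ 0 := by
  by_contra! h
  have hmin := isLocalMin_of_deriv_deriv_pos h hmax.deriv_eq_zero hc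
  have he : f =ᶠ[𝓝 x] fun _ => f x := by
    filter_upwards [hmax, hmin] with z h1 h2 using le_antisymm h1 h2
  have h2 : deriv f =ᶠ[𝓝 x] fun _ => 0 := by
    filter_upwards [he.eventually_nhds] with z hz
    rw [EventuallyEq.deriv_eq (f := fun _ => f x) hz]
    simp
  rw [h2.deriv_eq] at h
  simp at h

/-- The maximum principle for the fractional diffusion equation. -/
theorem nonpos_of_diffusion (h0 : 0 < α) (h1 : α < 1) (hw : MemW α w)
    (heq : ∀ p ∈ OmegaPlus, partialX (partialX w) p - caputoY α w p = 0)
    (hleft : ∀ y ∈ Icc (0 : ℝ) 1, w (0, y) = 0) (hright : ∀ y ∈ Icc (0 : ℝ) 1, w (1, y) = 0)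
    (hbot : ∀ x ∈ Icc (0 : ℝ) 1, w (x, 0) = 0) {p : ℝ × ℝ} (hp : p ∈ OmegaPlus) : w p ≤ 0 := by
  by_contra! hpos
  obtain ⟨hp1, hp2, hp3, hp4⟩ := hp
  -- Cutting at height `p.2 < 1` keeps a maximum on the top edge inside `OmegaPlus`. Such a maximum
  -- is harmless: the Caputo derivative involves earlier times only, and `u_xx` only the `x`
  -- direction.
  have hK : Icc (0 : ℝ) 1 ×ˢ Icc 0 p.2 ⊆ closure Omega :=
    (prod_mono_right (Icc_subset_Icc_right hp4.le)).trans Icc_prod_Icc_subset_closure_Omega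
  obtain ⟨⟨x, y⟩, hq, hmax⟩ := (isCompact_Icc.prod isCompact_Icc).exists_isMaxOn
    ⟨p, ⟨hp1.le, hp2.le⟩, hp3.le, le_rfl⟩ (hw.continuousOn.mono hK)
  have hmax' : ∀ q ∈ Icc (0 : ℝ) 1 ×ˢ Icc 0 p.2, w q ≤ w (x, y) := fun q hq => hmax hq
  have hwq : 0 < w (x, y) := hpos.trans_le (hmax' p ⟨⟨hp1.le, hp2.le⟩, hp3.le, le_rfl⟩)
  obtain ⟨⟨hx0, hx1⟩, hy0, hy1⟩ := hq
  simp only at hx0 hx1 hy0 hy1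
  have hx0' : 0 < x := hx0.lt_of_ne (by
    rintro rfl; rw [hleft y ⟨hy0, hy1.trans hp4.le⟩] at hwq; exact lt_irrefl _ hwq)
  have hx1' : x < 1 := hx1.lt_of_ne (by
    rintro rfl; rw [hright y ⟨hy0, hy1.trans hp4.le⟩] at hwq; exact lt_irrefl _ hwq)
  have hy0' : 0 < y := hy0.lt_of_ne (by
    rintro rfl; rw [hbot x ⟨hx0, hx1⟩] at hwq; exact lt_irrefl _ hwq)
  have hmem : (x, y) ∈ OmegaPlus := ⟨hx0', hx1', hy0', hy1.trans_lt hp4⟩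
  have hxx : partialX (partialX w) (x, y) ≤ 0 := by
    refine deriv_deriv_nonpos_of_isLocalMax (f := fun s => w (s, y)) ?_
      (hw.differentiable_x _ hmem).continuousAt
    filter_upwards [Ioo_mem_nhds hx0' hx1'] with s hs
    exact hmax' (s, y) ⟨⟨hs.1.le, hs.2.le⟩, hy0, hy1⟩
  have hcap : 0 < caputoY α w (x, y) := by
    refine caputo_pos_of_isMax h1 h0 hy0' (hw.hasCaputo _ hmem) ?_
      (hw.differentiableAt_right ⟨hx0', hx1'⟩ ⟨hy0', hy1.trans_lt hp4⟩) ?_ ?_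
    · exact hw.continuousOn.comp (f := fun s : ℝ => (x, s)) (by fun_prop) fun s hs =>
        hK ⟨⟨hx0, hx1⟩, hs.1, hs.2.trans hy1⟩
    · exact fun t ht => hmax' (x, t) ⟨⟨hx0, hx1⟩, ht.1, ht.2.trans hy1⟩
    · simpa [hbot x ⟨hx0, hx1⟩] using hwq
  linarith [heq _ hmem]

end TricomiCaputo

/-! ### The equation for the trace, and uniqueness. -/

namespace TricomiCaputo

variable {α γ₁ γ₂ : ℝ} {Q : ℝ → ℝ → ℝ} {Q₁ : ℝ → ℝ} {w : ℝ × ℝ → ℝ}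

/-- The second derivative of the trace on `AB` is the limit of `u_xx`, up to the constant
`caputoConst α` equal to the limit of `y ^ (1 - α) u_y`. -/
theorem deriv_deriv_trace_eq (h0 : 0 < α) (h1 : α < 1) (hw : MemW α w)
    (heq : ∀ p ∈ OmegaPlus, partialX (partialX w) p - caputoY α w p = 0)
    (hτ : ∀ x ∈ Ioo (0 : ℝ) 1, ContDiffAt ℝ 2 (fun s => w (s, 0)) x) {μ : ℝ → ℝ}
    (hμ : ContinuousOn μ (Ioo 0 1))
    (hlim : ∀ x ∈ Ioo (0 : ℝ) 1,
      Tendsto (fun y => y ^ (1 - α) * partialY w (x, y)) (𝓝[>] 0) (𝓝 (μ x)))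
    {x : ℝ} (hx : x ∈ Ioo (0 : ℝ) 1) :
    deriv (deriv fun s => w (s, 0)) x = caputoConst α * μ x := by
  -- The sequence is `1 / (n + 2)`: the shift keeps `y 0` below `1`, inside `OmegaPlus`.
  set y : ℕ → ℝ := fun n => 1 / ((n + 1 : ℕ) + 1 : ℝ) with hy
  have hyI : ∀ n, y n ∈ Ioo (0 : ℝ) 1 := by
    intro n
    refine ⟨by positivity, ?_⟩
    rw [hy, div_lt_one (by positivity)]
    push_cast
    linarith [(n.cast_nonneg : (0 : ℝ) ≤ n)]
  have hy0 : Tendsto y atTop (𝓝[>] 0) :=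
    tendsto_nhdsWithin_iff.2 ⟨(tendsto_one_div_add_atTop_nhds_zero_nat (𝕜 := ℝ)).comp
      (tendsto_add_atTop_nat 1), Eventually.of_forall fun n => (hyI n).1⟩
  have hmem : ∀ n, ∀ x ∈ Ioo (0 : ℝ) 1, (x, y n) ∈ OmegaPlus := fun n x hx =>
    ⟨hx.1, hx.2, (hyI n).1, (hyI n).2⟩
  obtain ⟨C, hC⟩ := (isCompact_Icc.prod isCompact_Icc).exists_bound_of_continuousOn
    (hw.continuousOn.mono Icc_prod_Icc_subset_closure_Omega)
  have hτ'' : ContinuousOn (deriv (deriv fun s => w (s, 0))) (Ioo 0 1) := fun z hz =>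
    (((hτ z hz).derivWithin (m := 1) (by norm_num)).derivWithin
      (m := 0) (by norm_num)).continuousAt.continuousWithinAt
  refine second_deriv_eq_of_tendsto (f := fun n s => w (s, y n))
    (f' := fun n s => partialX w (s, y n)) (f'' := fun n s => partialX (partialX w) (s, y n))
    (τ := fun s => w (s, 0)) (τ' := deriv fun s => w (s, 0)) (C := C)
    (h := fun x => caputoConst α * μ x)
    (fun n z hz => (hw.differentiable_x _ (hmem n z hz)).hasDerivAt)
    (fun n z hz => (hw.differentiable_xx _ (hmem n z hz)).hasDerivAt)
    (fun n => hw.continuousOn_xx.comp (f := fun s : ℝ => (s, y n)) (by fun_prop) (hmem n))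
    (fun n z hz => hC (z, y n) ⟨Ioo_subset_Icc_self hz, Ioo_subset_Icc_self (hyI n)⟩)
    (fun z hz => ?_) (fun z hz => ?_)
    (fun z hz => ((hτ z hz).differentiableAt (by simp)).hasDerivAt)
    (fun z hz => (differentiableAt_deriv_of_contDiffAt_two (hτ z hz)).hasDerivAt)
    hτ'' (by fun_prop) hx
  · refine hw.tendsto_comp (p := (z, 0)) ?_
      (Eventually.of_forall fun n => Or.inl (Or.inl (hmem n z hz)))
    exact tendsto_const_nhds.prodMk_nhds (tendsto_nhdsWithin_iff.1 hy0).1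
  · have := (tendsto_caputo h0 h1 (f := fun s => w (z, s))
      (fun r hr => hw.hasCaputo (z, r) ⟨hz.1, hz.2, hr.1, hr.2⟩) (hlim z hz)).comp hy0
    refine this.congr fun n => ?_
    exact (sub_eq_zero.1 (heq _ (hmem n z hz))).symm

/-- A solution of the homogeneous problem vanishes on `AB`. -/
theorem IsSolution.trace_eq_zero (h0 : 0 < α) (h1 : α < 1) (hγ₂ : 0 ≤ γ₂)
    (hQ : ContinuousOn (fun p : ℝ × ℝ => Q p.1 p.2) {p | 0 ≤ p.2 ∧ p.2 ≤ p.1 ∧ p.1 ≤ 1})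
    (hQ₁ : ContinuousOn Q₁ (Icc 0 1))
    (hQt : ∀ x t : ℝ, 0 < t → t < x → x < 1 → HasDerivAt (fun s => Q x s) (-(Q₁ x * Q₁ t)) t)
    (hQpos : ∀ x ∈ Ioo (0 : ℝ) 1, 0 < Q x x) (hw : IsSolution α γ₁ γ₂ Q 0 0 0 w) :
    ∀ x ∈ Icc (0 : ℝ) 1, w (x, 0) = 0 := by
  have htr : ∀ p ∈ OmegaMinus, w p = w (p.1 + p.2, 0) := fun p hp =>
    eq_trace_of_wave hw.memW hw.eq_minus hw.characteristic hp
  have hτ : ∀ x ∈ Ioo (0 : ℝ) 1, ContDiffAt ℝ 2 (fun s => w (s, 0)) x := fun x hx =>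
    contDiffAt_trace hw.memW htr hx
  have hcτ : ContinuousOn (fun s => w (s, 0)) (Icc 0 1) :=
    hw.memW.continuousOn.comp (f := fun s : ℝ => (s, (0 : ℝ))) (by fun_prop) fun s hs =>
      Icc_prod_Icc_subset_closure_Omega ⟨hs, by simp⟩
  have hτ0 : w (0, 0) = 0 := hw.left 0 (by simp)
  have hτ1 : w (1, 0) = 0 := hw.right 0 (by simp)
  have hd : ∀ x ∈ Ioo (0 : ℝ) 1, HasDerivAt (fun s => w (s, 0)) (deriv (fun s => w (s, 0)) x) x :=
    fun x hx => ((hτ x hx).differentiableAt (by simp)).hasDerivAt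
  have hd' : ∀ x ∈ Ioo (0 : ℝ) 1,
      HasDerivAt (deriv fun s => w (s, 0)) (deriv (deriv fun s => w (s, 0)) x) x :=
    fun x hx => (differentiableAt_deriv_of_contDiffAt_two (hτ x hx)).hasDerivAt
  have hcτ' : ContinuousOn (deriv fun s => w (s, 0)) (Ioo 0 1) := fun x hx =>
    (hd' x hx).continuousAt.continuousWithinAt
  have hg : ContinuousOn (fun t => Q₁ t * w (t, 0)) (Icc 0 1) := hQ₁.mul hcτ
  obtain ⟨ν, hν, hglue⟩ := hw.gluing
  have hνeq : ∀ x ∈ Ioo (0 : ℝ) 1, ν x = deriv (fun s => w (s, 0)) x := fun x hx =>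
    tendsto_nhds_unique (hν x hx) (tendsto_partialY_trace hw.memW htr hx)
  set S : ℝ → ℝ := fun x => ∫ t in (0 : ℝ)..x, Q₁ t * w (t, 0) with hS
  set μ : ℝ → ℝ := fun x => γ₁ * deriv (fun s => w (s, 0)) x +
    γ₂ * (w (x, 0) * Q x x + Q₁ x * S x) with hμdef
  have hlim : ∀ x ∈ Ioo (0 : ℝ) 1,
      Tendsto (fun y => y ^ (1 - α) * partialY w (x, y)) (𝓝[>] 0) (𝓝 (μ x)) := by
    intro x hx
    obtain ⟨J, hJ, hl⟩ := hglue x hx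
    have e : ∀ ε ∈ Ioo 0 x, EqOn (fun t => ν t * Q x t)
        (fun t => deriv (fun s => w (s, 0)) t * Q x t) (uIcc ε x) := by
      intro ε hε t ht
      rw [uIcc_of_le hε.2.le] at ht
      simp only
      rw [hνeq t ⟨hε.1.trans_le ht.1, ht.2.trans_lt hx.2⟩]
    have hJ' : HasImproperIntegral (fun t => deriv (fun s => w (s, 0)) t * Q x t) x J := by
      refine ⟨fun ε hε => (hJ.1 ε hε).congr_uIoo ((e ε hε).mono Ioo_subset_Icc_self),
        hJ.2.congr' ?_⟩
      filter_upwards [Ioo_mem_nhdsGT hx.1] with ε hε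
      exact intervalIntegral.integral_congr (e ε hε)
    rwa [hνeq x hx, improperIntegral_eq hQ hQ₁ hQt hcτ hτ0 hd hx hJ'] at hl
  have hQd : ContinuousOn (fun x => Q x x) (Ioo 0 1) :=
    hQ.comp (f := fun x : ℝ => (x, x)) (by fun_prop) fun x hx => ⟨hx.1.le, le_rfl, hx.2.le⟩
  have hSd : ∀ x ∈ Ioo (0 : ℝ) 1, HasDerivAt S (Q₁ x * w (x, 0)) x := fun x hx =>
    hasDerivAt_integral_zero hg hx
  have hSc : ContinuousOn S (Ioo 0 1) := fun x hx => (hSd x hx).continuousAt.continuousWithinAt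
  have hμ : ContinuousOn μ (Ioo 0 1) := by
    have a := hcτ.mono Ioo_subset_Icc_self
    have b := hQ₁.mono Ioo_subset_Icc_self
    exact (continuousOn_const.mul hcτ').add
      (continuousOn_const.mul ((a.mul hQd).add (b.mul hSc)))
  refine eq_zero_of_integro_ode (q := fun x => Q x x) (A := caputoConst α * γ₁)
    (B := caputoConst α * γ₂) (mul_nonneg (caputoConst_pos h0 h1).le hγ₂) hcτ hτ0 hτ1 hd hd'
    (fun x hx => (hQpos x hx).le) hSd (tendsto_integral_zero hg) fun x hx => ?_
  rw [deriv_deriv_trace_eq h0 h1 hw.memW hw.eq_plus hτ hμ hlim hx, hμdef]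
  ring

/-- A solution of the homogeneous problem is nonpositive. -/
theorem IsSolution.nonpos (h0 : 0 < α) (h1 : α < 1) (hγ₂ : 0 ≤ γ₂)
    (hQ : ContinuousOn (fun p : ℝ × ℝ => Q p.1 p.2) {p | 0 ≤ p.2 ∧ p.2 ≤ p.1 ∧ p.1 ≤ 1})
    (hQ₁ : ContinuousOn Q₁ (Icc 0 1))
    (hQt : ∀ x t : ℝ, 0 < t → t < x → x < 1 → HasDerivAt (fun s => Q x s) (-(Q₁ x * Q₁ t)) t)
    (hQpos : ∀ x ∈ Ioo (0 : ℝ) 1, 0 < Q x x) (hw : IsSolution α γ₁ γ₂ Q 0 0 0 w) :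
    ∀ p ∈ Omega, w p ≤ 0 := by
  have hτ := hw.trace_eq_zero h0 h1 hγ₂ hQ hQ₁ hQt hQpos
  rintro p ((hp | hp) | hp)
  · exact nonpos_of_diffusion h0 h1 hw.memW hw.eq_plus hw.left hw.right hτ hp
  · rw [eq_trace_of_wave hw.memW hw.eq_minus hw.characteristic hp]
    obtain ⟨a, b, c, d⟩ := hp
    exact (hτ _ ⟨by linarith, by linarith⟩).le
  · obtain ⟨x, y⟩ := p
    obtain ⟨a, b, rfl⟩ := hp
    exact (hτ x ⟨a.le, b.le⟩).le

end TricomiCaputo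

theorem theorem1 (α : ℝ) (hα0 : 0 < α) (hα1 : α < 1)
    (γ₁ γ₂ : ℝ) (hγ : γ₁ ^ 2 + γ₂ ^ 2 ≠ 0)
    (φ₁ φ₂ ψ : ℝ → ℝ) (hφψ : φ₁ 0 = ψ 0)
    (Q : ℝ → ℝ → ℝ) (Q₁ : ℝ → ℝ)
    (hQ : ContinuousOn (fun p : ℝ × ℝ => Q p.1 p.2) {p | 0 ≤ p.2 ∧ p.2 ≤ p.1 ∧ p.1 ≤ 1})
    (hQ₁ : ContinuousOn Q₁ (Set.Icc 0 1))
    (hγ₂ : 0 ≤ γ₂)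
    (hQt : ∀ x t : ℝ, 0 < t → t < x → x < 1 → HasDerivAt (fun s => Q x s) (-(Q₁ x * Q₁ t)) t)
    (hQpos : ∀ x ∈ Set.Ioo (0 : ℝ) 1, 0 < Q x x)
    (u v : ℝ × ℝ → ℝ)
    (hu : TricomiCaputo.IsSolution α γ₁ γ₂ Q φ₁ φ₂ ψ u)
    (hv : TricomiCaputo.IsSolution α γ₁ γ₂ Q φ₁ φ₂ ψ v) :
    ∀ p ∈ closure TricomiCaputo.Omega, u p = v p := by
  -- Both `u - v` and `v - u` solve the homogeneous problem, so the one-sided bound suffices;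
  -- continuity then extends equality to the closure.
  have huv : EqOn u v TricomiCaputo.Omega := fun p hp =>
    le_antisymm (sub_nonpos.1 ((hu.sub hv).nonpos hα0 hα1 hγ₂ hQ hQ₁ hQt hQpos p hp))
      (sub_nonpos.1 ((hv.sub hu).nonpos hα0 hα1 hγ₂ hQ hQ₁ hQt hQpos p hp))
  exact huv.of_subset_closure hu.memW.continuousOn hv.memW.continuousOn subset_closure subset_rfl
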